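/- All Banach spaces are real. Let $C(2^{\mathbb N})$ be the Banach space of continuous real functions on the Cantor space with the supremum norm. Let $\mathrm{SB}$ be the set of closed linear subspaces of $C(2^{\mathbb N})$ with the relative Effros--Borel structure, that is, the $\sigma$-algebra generated by the sets $\{X : X\cap U\neq\varnothing\}$, $U\subseteq C(2^{\mathbb N})$ open. A subset of a standard Borel space is analytic if it is empty or the image of $\mathbb N^{\mathbb N}$ under a Borel map. Canonical triple. Let $B, E$ be Banach spaces, $S$ a subspace of $B$ and $u:S\to E$ linear with $\|u\|\le 1$. Put $E_1=(B\oplus_1 E)/N$, where $N=\{(s,-u(s)):s\in S\}$, let $Q$ be the quotient map, and let $\tilde u(b)=Q(b,0)$ and $j(x)=Q(0,x)$. Then $j$ is an isometric embedding. The construction. Let $\lambda>1$, $\frac1\lambda<\eta<1$ and $\varepsilon>0$ with $1+\varepsilon<\lambda\eta$. Let $X$ be a separable Banach space and $(F_n)_{n\ge 0}$ an increasing sequence of finite-dimensional subspaces of $X$ with dense union (a filtration of $X$). Put $E_0=X$ and $G_0=\{0\}$. Given $E_k$, a finite-dimensional subspace $G_k\subseteq E_k$ and isometric embeddings $j_0,\dots,j_{k-1}$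 with $j_i:E_i\to E_{i+1}$, let $H_k=\mathrm{span}\big((j_{k-1}\circ\dots\circ j_0)(F_k)\cup G_k\big)$ and let $m_k$ be the least integer $m\ge k+1$ for which there are a subspace $S$ of $\ell_\infty^{m}$ and an isomorphism $T:S\to H_k$ with $\|s\|\le\|T(s)\|\le(1+\varepsilon)\|s\|$ for all $s\in S$. Choose such $S_k\subseteq\ell_\infty^{m_k}$ and $T_k$, put $u_k=\frac1\lambda T_k$, and let $(E_{k+1},j_k,\tilde u_k)$ be the canonical triple of $\ell_\infty^{m_k}, S_k, u_k, E_k$, and $G_{k+1}=\tilde u_k(\ell_\infty^{m_k})$. Let $Z$ be the inductive limit of $(E_n,j_n)$, that is, the Hausdorff completion of the space of sequences $(x_n)\in\prod_nE_n$ with $j_n(x_n)=x_{n+1}$ for all large $n$ under the seminorm $\lim_n\|x_n\|$, and let $J_n:E_n\to Z$ be the canonical embeddings. A Bourgain--Pisier space $\mathcal L_\lambda[X]$ for $X$ and $(F_n)$ is the closure of $\bigcup_nJ_n(G_n)$ in $Z$, for some choice of the $S_k$ and $T_k$. Theorem. Let $\lambda>1$, and let $\eta,\varepsilon$ be as above.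 1. For every $X\in\mathrm{SB}$ and every filtration $(F_n)$ of $X$ there is $Y\in\mathrm{SB}$ that is linearly isometric to a Bourgain--Pisier space $\mathcal L_\lambda[X]$ for $X$ and $(F_n)$. 2. The set of all $(X,Y)\in\mathrm{SB}\times\mathrm{SB}$ such that $Y$ is linearly isometric to a Bourgain--Pisier space $\mathcal L_\lambda[X]$ for $X$ and some filtration $(F_n)$ of $X$ is analytic. 3. Let $d_n:\mathrm{SB}\to C(2^{\mathbb N})$, $n\ge0$, be Borel maps such that $d_n(X)\in X$ for all $n$ and $\{d_n(X):n\ge0\}$ is dense in $X$, for every $X\in\mathrm{SB}$. Then the set of all $(X,Y)\in\mathrm{SB}\times\mathrm{SB}$ such that $Y$ is linearly isometric to a Bourgain--Pisier space $\mathcal L_\lambda[X]$ for $X$ and the filtration $F_n(X)=\mathrm{span}\{d_i(X):i\le n\}$ is analytic. -/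

import Mathlib

open Filter Topology

noncomputable section

namespace BourgainPisier

/-! ### The standard Borel space of separable Banach spaces -/

/-- The Banach space `C(2^ℕ)` of real continuous functions on the Cantor space (sup norm). -/
abbrev CantorFun : Type := C(ℕ → Bool, ℝ)

instance : MeasurableSpace CantorFun := borel CantorFun

instance : BorelSpace CantorFun := ⟨rfl⟩

/-- The Effros-Borel structure on the closed subsets of a topological space: the `σ`-algebra
generated by the sets `{F | F ∩ U ≠ ∅}`, `U` open. -/
instance effrosBorel (α : Type*) [TopologicalSpace α] :
    MeasurableSpace (TopologicalSpace.Closeds α) :=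
  MeasurableSpace.generateFrom
    {A | ∃ U : Set α, IsOpen U ∧
      A = {F : TopologicalSpace.Closeds α | ((F : Set α) ∩ U).Nonempty}}

/-- `SB`: all closed linear subspaces of `C(2^ℕ)`. -/
abbrev SB : Type := ClosedSubmodule ℝ CantorFun

/-- The relative Effros-Borel structure on `SB`. -/
instance : MeasurableSpace SB :=
  MeasurableSpace.comap (fun X : SB => X.toCloseds) inferInstance

/-- Analytic subsets of a (standard Borel) measurable space: the empty set and the images of the
Baire space under Borel maps. -/
def IsAnalytic {α : Type*} [MeasurableSpace α] (A : Set α) : Prop :=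
  A = ∅ ∨ ∃ f : (ℕ → ℕ) → α, Measurable f ∧ Set.range f = A

/-! ### Inductive limits of systems of isometric embeddings -/

section InductiveLimit

variable {E : ℕ → Type} [∀ n, NormedAddCommGroup (E n)] [∀ n, NormedSpace ℝ (E n)]
  (j : ∀ n, E n →ₗᵢ[ℝ] E (n + 1))

/-- The sequences `(x_n)` in `Π_n E_n` with `j_n(x_n) = x_{n+1}` for all large `n`. -/
def evCoherent : Submodule ℝ (∀ n, E n) where
  carrier := {x | ∀ᶠ n in atTop, j n (x n) = x (n + 1)}
  add_mem' := by
    intro a b ha hb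
    filter_upwards [ha, hb] with n h1 h2
    simp [h1, h2]
  zero_mem' := by simp
  smul_mem' := by
    intro c x hx
    filter_upwards [hx] with n h
    simp [h]

/-- The space of eventually coherent sequences, to be given the seminorm `lim_n ‖x_n‖`. -/
def PreLimit : Type := evCoherent j

instance : AddCommGroup (PreLimit j) := inferInstanceAs (AddCommGroup (evCoherent j))

instance : Module ℝ (PreLimit j) := inferInstanceAs (Module ℝ (evCoherent j))

/-- The seminorm `lim_n ‖x_n‖`. -/
def preNorm (x : PreLimit j) : ℝ := limUnder atTop (fun n => ‖x.1 n‖)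

/-- The norms of an eventually coherent sequence are eventually constant, hence converge. -/
theorem tendsto_preNorm (x : PreLimit j) :
    Tendsto (fun n => ‖x.1 n‖) atTop (𝓝 (preNorm j x)) := by
  have hx : ∀ᶠ n in atTop, j n (x.1 n) = x.1 (n + 1) := x.2
  obtain ⟨N, hN⟩ := eventually_atTop.1 hx
  have hconst : ∀ n ≥ N, ‖x.1 n‖ = ‖x.1 N‖ := by
    intro n hn
    induction n, hn using Nat.le_induction with
    | base => rfl
    | succ n hn ih => rw [← hN n hn, (j n).norm_map, ih]
  have : Tendsto (fun n => ‖x.1 n‖) atTop (𝓝 ‖x.1 N‖) :=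
    tendsto_const_nhds.congr' (eventually_atTop.2 ⟨N, fun n hn => (hconst n hn).symm⟩)
  exact tendsto_nhds_limUnder ⟨_, this⟩

/-- `lim_n ‖x_n‖` as a seminorm. -/
def preSeminorm : Seminorm ℝ (PreLimit j) :=
  Seminorm.of (preNorm j)
    (by
      intro x y
      refine le_of_tendsto_of_tendsto' (tendsto_preNorm j (x + y))
        ((tendsto_preNorm j x).add (tendsto_preNorm j y)) (fun n => ?_)
      exact norm_add_le (x.1 n) (y.1 n))
    (by
      intro a x
      refine tendsto_nhds_unique (tendsto_preNorm j (a • x)) ?_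
      refine ((tendsto_preNorm j x).const_mul ‖a‖).congr (fun n => ?_)
      exact (norm_smul a (x.1 n)).symm)

instance : SeminormedAddCommGroup (PreLimit j) :=
  (preSeminorm j).toAddGroupSeminorm.toSeminormedAddCommGroup

instance : NormedSpace ℝ (PreLimit j) where
  norm_smul_le a x := (map_smul_eq_mul (preSeminorm j) a x).le

/-- The inductive limit: the Hausdorff completion of the space of eventually coherent sequences
under the seminorm `lim_n ‖x_n‖` (this includes the passage to the quotient by its kernel). -/
abbrev IndLimit : Type := UniformSpace.Completion (PreLimit j)

/-- The sequence `(0, …, 0, x, j_n x, j_{n+1} j_n x, …)`, with `x` in position `n`. -/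
def pushSeq (n : ℕ) (x : E n) : PreLimit j :=
  ⟨fun m => if h : n ≤ m then Nat.leRecOn h (fun {k} y => j k y) x else 0, by
    change ∀ᶠ m in atTop, _
    filter_upwards [eventually_ge_atTop n] with m hm
    rw [dif_pos hm, dif_pos (Nat.le_succ_of_le hm), Nat.leRecOn_succ hm]⟩

/-- The canonical embedding `J_n : E_n → Z` into the inductive limit. -/
def toIndLimit (n : ℕ) (x : E n) : IndLimit j := ((pushSeq j n x : PreLimit j) : IndLimit j)

/-- The composition `j_{n-1} ∘ ⋯ ∘ j_0`, preceded by an isometry of `X` onto `E_0`. -/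
def iterEmb {X : Type} [NormedAddCommGroup X] [NormedSpace ℝ X] (e : X ≃ₗᵢ[ℝ] E 0) :
    ∀ n, X →ₗᵢ[ℝ] E n
  | 0 => e.toLinearIsometry
  | n + 1 => (j n).comp (iterEmb e n)

end InductiveLimit

/-! ### The canonical triple -/

section Kisliakov

variable {B X : Type} [NormedAddCommGroup B] [NormedSpace ℝ B]
  [NormedAddCommGroup X] [NormedSpace ℝ X] (S : Submodule ℝ B) (u : S →ₗ[ℝ] X)

/-- The subspace `N = {(s, -u(s)) : s ∈ S}` of `B ⊕₁ X`. -/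
def kisliakovN : Submodule ℝ (WithLp 1 (B × X)) where
  carrier := {z | ∃ s : S, z = WithLp.toLp 1 ((s : B), -u s)}
  add_mem' := by
    rintro _ _ ⟨s, rfl⟩ ⟨t, rfl⟩
    refine ⟨s + t, ?_⟩
    rw [← WithLp.toLp_add, Prod.mk_add_mk, map_add, neg_add, Submodule.coe_add]
  zero_mem' := ⟨0, by simp only [map_zero, neg_zero, Submodule.coe_zero]; rfl⟩
  smul_mem' := by
    rintro c _ ⟨s, rfl⟩
    refine ⟨c • s, ?_⟩
    rw [← WithLp.toLp_smul, Prod.smul_mk, map_smul, smul_neg, Submodule.coe_smul]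

/-- The space `X_1 = (B ⊕₁ X) / N`, with the quotient norm. -/
abbrev Kisliakov : Type := WithLp 1 (B × X) ⧸ kisliakovN S u

/-- `ũ(b) = Q(b, 0)`. -/
def kisliakovU (b : B) : Kisliakov S u :=
  Submodule.Quotient.mk (WithLp.toLp 1 (b, (0 : X)))

/-- `j(x) = Q(0, x)`. -/
def kisliakovJ (x : X) : Kisliakov S u :=
  Submodule.Quotient.mk (WithLp.toLp 1 ((0 : B), x))

end Kisliakov

/-! ### The Bourgain-Pisier construction -/

section Construction

/-- There are a subspace `S` of `ℓ_∞^m` and an isomorphism `T : S → H` such that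
`‖s‖ ≤ ‖T s‖ ≤ (1 + ε) ‖s‖`.  (`Fin m → ℝ` carries the supremum norm.) -/
def AlmostEmbeds (ε : ℝ) (m : ℕ) (H : Type) [NormedAddCommGroup H] [NormedSpace ℝ H] : Prop :=
  ∃ (S : Submodule ℝ (Fin m → ℝ)) (T : S ≃ₗ[ℝ] H), ∀ s : S, ‖s‖ ≤ ‖T s‖ ∧ ‖T s‖ ≤ (1 + ε) * ‖s‖

variable {X : Type} [NormedAddCommGroup X] [NormedSpace ℝ X]

/-- An increasing sequence of finite-dimensional subspaces with dense union. -/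
structure IsFiltration (F : ℕ → Submodule ℝ X) : Prop where
  finite : ∀ n, FiniteDimensional ℝ (F n)
  mono : Monotone F
  dense : Dense (⋃ n, (F n : Set X))

/-- A run of the Bourgain-Pisier construction for the space `X`, the sequence `(F_n)` and the
parameters `lam` and `ε`.  All spaces are taken up to isometry: `E 0` is `X` via `e`, and
`E (k + 1)` is the space of the canonical triple of `(ℓ_∞^{m_k}, S_k, u_k, E_k)` via `Φ k`. -/
structure BPSystem (lam ε : ℝ) (F : ℕ → Submodule ℝ X) where
  E : ℕ → Type
  [grp : ∀ n, NormedAddCommGroup (E n)]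
  [spc : ∀ n, NormedSpace ℝ (E n)]
  j : ∀ n, E n →ₗᵢ[ℝ] E (n + 1)
  G : ∀ n, Submodule ℝ (E n)
  e : X ≃ₗᵢ[ℝ] E 0
  G_zero : G 0 = ⊥
  /-- `H_k` is spanned by `(j_{k-1} ∘ ⋯ ∘ j_0)(F_k) ∪ G_k`. -/
  H : ∀ n, Submodule ℝ (E n)
  H_eq : ∀ k, H k = Submodule.span ℝ ((iterEmb j e k '' (F k : Set X)) ∪ (G k : Set (E k)))
  /-- `m_k` is the least admissible integer `≥ k + 1`. -/
  m : ℕ → ℕ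
  m_least : ∀ k, IsLeast {d | k + 1 ≤ d ∧ AlmostEmbeds ε d (H k)} (m k)
  S : ∀ k, Submodule ℝ (Fin (m k) → ℝ)
  T : ∀ k, S k ≃ₗ[ℝ] H k
  T_bound : ∀ k (s : S k), ‖s‖ ≤ ‖T k s‖ ∧ ‖T k s‖ ≤ (1 + ε) * ‖s‖
  /-- `u_k(s) = λ⁻¹ T(s)`. -/
  u : ∀ k, S k →ₗ[ℝ] E k
  u_eq : ∀ k (s : S k), u k s = (1 / lam) • (T k s : E k)
  Φ : ∀ k, Kisliakov (S k) (u k) ≃ₗᵢ[ℝ] E (k + 1)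
  j_eq : ∀ k (x : E k), j k x = Φ k (kisliakovJ (S k) (u k) x)
  /-- `G_{k+1} = ũ_k(ℓ_∞^{m_k})`. -/
  G_succ : ∀ k, (G (k + 1) : Set (E (k + 1))) =
    Set.range (fun b : Fin (m k) → ℝ => Φ k (kisliakovU (S k) (u k) b))

attribute [instance] BPSystem.grp BPSystem.spc

/-- `Y` is (linearly) isometric to the space `L_λ[X]`, the closure of `⋃_n J_n(G_n)` in the
inductive limit of `(E_n, j_n)`, produced by some run of the construction for `X` and `(F_n)`. -/
def IsBPSpace (lam ε : ℝ) (F : ℕ → Submodule ℝ X)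
    (Y : Type) [NormedAddCommGroup Y] [NormedSpace ℝ Y] : Prop :=
  ∃ (P : BPSystem lam ε F) (φ : Y →ₗᵢ[ℝ] IndLimit P.j),
    Set.range φ = closure (⋃ n, toIndLimit P.j n '' (P.G n : Set (P.E n)))

end Construction

/-- The subspaces `F_n(X) = span {d_i(X) : i ≤ n}` of `X`. -/
def selectorSpan (d : ℕ → SB → CantorFun) (X : SB) (n : ℕ) : Submodule ℝ X.toSubmodule :=
  Submodule.span ℝ {x | ∃ i ≤ n, (x : CantorFun) = d i X}

end BourgainPisier

end

noncomputable section

namespace BourgainPisier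

/-! Existence is the construction carried out inside separable spaces. Each H_k is
finite-dimensional, hence embeds (1 + ε)-isometrically into ℓ_∞^d for large d
(`exists_almostEmbeds`), so m_k exists. Since 1 + ε ≤ λ, the map u_k = λ⁻¹T_k is a contraction, and
this is what makes j_k isometric. The inductive limit is separable, so it embeds isometrically into
C(2^ℕ), and the closure of ⋃ J_n(G_n) is carried onto a point of `SB`.

For analyticity, quantification over runs of the construction, which involve abstract Banach spaces,
is replaced by quantification over sequences of vectors. Once the limit lies in C(2^ℕ), the j_k
become inclusions, and a run is recorded by a sequence x spanning a copy of X densely, the integers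
m_k, the images g (k, i) of the unit vectors under ũ_k, and the preimages s under T_k of the
generators of H_k. The quotient defining E_{k+1} need not be mentioned, because the canonical triple
is characterised up to isometry by ‖ũ(b) + j(e)‖ = inf over s ∈ S of ‖b + s‖ + ‖e - u(s)‖
(`exists_kisliakov_equiv`). By density it suffices to impose this formula on countably many pairs
(b, e).

The delicate condition is minimality of m_k, which asserts that no embedding into a smaller ℓ_∞^d
exists. The vectors realising such an embedding can be sought in a compact set, so the existence of
one is a closed condition on the generators (`isClosed_setOf_exists_fits`) and its negation is open.
Hence the codes form a Borel subset of a Polish space.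

Codes give Bourgain–Pisier spaces (`isBPSpace_of_isStepCode`), and every such space has a code
(`exists_isStepCode_of_isBPSpace`). Isometry of X and Y with their copies in the ambient space is
expressed by equality of the norms of linear combinations of generators. The map sending a code to
the pair of closed spans is Borel, so its image is analytic. For prescribed selectors d_n, one
further Borel condition fixes the generators of X. -/

/-! ### Universality of `C(2^ℕ)` -/

/-- **Banach–Mazur theorem**: separable normed spaces embed isometrically into `C(2^ℕ)`. -/
theorem exists_linearIsometry_cantorFun (V : Type*) [NormedAddCommGroup V] [NormedSpace ℝ V]
    [TopologicalSpace.SeparableSpace V] : Nonempty (V →ₗᵢ[ℝ] CantorFun) := by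
  -- The weak* dual ball is compact, and metrizable because V is separable, so it is a continuous
  -- image of the Cantor space. V embeds by evaluation along that surjection; norming functionals
  -- make the embedding isometric.
  let K : Set (WeakDual ℝ V) :=
    WeakDual.toStrongDual ⁻¹' Metric.closedBall (0 : StrongDual ℝ V) 1
  have hK : IsCompact K := WeakDual.isCompact_closedBall 0 1
  have : CompactSpace K := isCompact_iff_compactSpace.mp hK
  have : TopologicalSpace.MetrizableSpace K := WeakDual.metrizable_of_isCompact ℝ V K hK
  let : MetricSpace K := TopologicalSpace.metrizableSpaceMetric K
  have : Nonempty K := ⟨⟨0, by simp [K]⟩⟩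
  obtain ⟨f, hf, hfs⟩ := exists_nat_bool_continuous_surjective_of_compact K
  let ev : V →ₗ[ℝ] CantorFun :=
    { toFun := fun v => ⟨fun t => (f t : WeakDual ℝ V) v,
        (WeakDual.eval_continuous v).comp (continuous_subtype_val.comp hf)⟩
      map_add' := fun v w => by ext t; simp
      map_smul' := fun c v => by ext t; simp }
  refine ⟨⟨ev, fun v => le_antisymm ?_ ?_⟩⟩
  · refine (ContinuousMap.norm_le _ (norm_nonneg v)).2 fun t => ?_
    have h1 : ‖WeakDual.toStrongDual (f t : WeakDual ℝ V)‖ ≤ 1 := by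
      have h : WeakDual.toStrongDual (f t : WeakDual ℝ V) ∈ Metric.closedBall 0 1 := (f t).2
      rwa [mem_closedBall_zero_iff] at h
    calc ‖WeakDual.toStrongDual (f t : WeakDual ℝ V) v‖
        ≤ ‖WeakDual.toStrongDual (f t : WeakDual ℝ V)‖ * ‖v‖ := ContinuousLinearMap.le_opNorm _ _
      _ ≤ 1 * ‖v‖ := by gcongr
      _ = ‖v‖ := one_mul _
  · obtain ⟨g, hg, hgv⟩ := exists_dual_vector'' ℝ v
    obtain ⟨t, ht⟩ := hfs ⟨StrongDual.toWeakDual g, by simpa [K] using hg⟩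
    have h := (ev v).norm_coe_le_norm t
    have h2 : ev v t = ‖v‖ := by
      change (f t : WeakDual ℝ V) v = ‖v‖
      rw [ht]
      exact hgv
    rw [h2] at h
    simpa using h

/-! ### Linear combinations of a family -/

section Span

variable {ι V W : Type*} [NormedAddCommGroup V] [NormedSpace ℝ V]
  [NormedAddCommGroup W] [NormedSpace ℝ W]

/-- The linear combination `∑ c_r w_r` with coefficients `c`. -/
abbrev comb (w : ι → V) (c : ι →₀ ℝ) : V := Finsupp.linearCombination ℝ w c

/-- The rational linear combination `∑ c_r w_r`. -/
def ratComb (w : ι → V) (c : ι →₀ ℚ) : V := comb w (c.mapRange (Rat.cast : ℚ → ℝ) Rat.cast_zero)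

theorem ratComb_add (w : ι → V) (c d : ι →₀ ℚ) : ratComb w (c + d) = ratComb w c + ratComb w d := by
  unfold ratComb comb
  rw [Finsupp.mapRange_add (by simp), map_add]

theorem ratComb_smul (w : ι → V) (q : ℚ) (c : ι →₀ ℚ) :
    ratComb w (q • c) = (q : ℝ) • ratComb w c := by
  unfold ratComb comb
  rw [← map_smul]
  congr 1
  ext i
  simp

theorem ratComb_single (w : ι → V) (r : ι) (q : ℚ) :
    ratComb w (Finsupp.single r q) = (q : ℝ) • w r := by
  simp [ratComb, comb]

/-- Rational linear combinations are dense in the closed real span. -/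
theorem topologicalClosure_span_le_closure_ratComb (w : ι → V) :
    ((Submodule.span ℝ (Set.range w)).topologicalClosure : Set V) ⊆
      closure (Set.range (ratComb w)) := by
  let A : AddSubmonoid V :=
    { carrier := Set.range (ratComb w)
      zero_mem' := ⟨0, by simp [ratComb]⟩
      add_mem' := by
        rintro _ _ ⟨c, rfl⟩ ⟨d, rfl⟩
        exact ⟨c + d, ratComb_add w c d⟩ }
  have hA : (A.topologicalClosure : Set V) = closure (Set.range (ratComb w)) := rfl
  rw [← hA, Submodule.topologicalClosure_coe]
  refine closure_minimal ?_ A.isClosed_topologicalClosure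
  -- Real multiples stay in the closure: approximate the scalar by rationals with the vector fixed,
  -- then the vector with the scalar fixed.
  have hsmul : ∀ (r : ℝ) (x : V), x ∈ A.topologicalClosure → r • x ∈ A.topologicalClosure := by
    have h1 : ∀ (r : ℝ) (x : V), x ∈ A → r • x ∈ A.topologicalClosure := by
      rintro r _ ⟨c, rfl⟩
      have hcl : IsClosed {r : ℝ | r • ratComb w c ∈ A.topologicalClosure} :=
        A.isClosed_topologicalClosure.preimage (continuous_id.smul continuous_const)
      have : DenseRange (Rat.cast : ℚ → ℝ) := Rat.denseRange_cast
      refine this.induction_on (p := fun r => r • ratComb w c ∈ A.topologicalClosure) r hcl ?_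
      intro q
      refine A.le_topologicalClosure ⟨q • c, ratComb_smul w q c⟩
    intro r x hx
    have hcl : IsClosed {x : V | r • x ∈ A.topologicalClosure} :=
      A.isClosed_topologicalClosure.preimage (continuous_const_smul r)
    exact closure_minimal (fun y hy => h1 r y hy) hcl hx
  intro x hx
  induction hx using Submodule.span_induction with
  | mem x hx =>
    obtain ⟨r, rfl⟩ := hx
    exact A.le_topologicalClosure ⟨Finsupp.single r 1, by simp [ratComb_single]⟩
  | zero => exact A.topologicalClosure.zero_mem
  | add x y _ _ hx hy => exact A.topologicalClosure.add_mem hx hy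
  | smul r x _ hx => exact hsmul r x hx

theorem range_comb (w : ι → V) : Set.range (comb w) = Submodule.span ℝ (Set.range w) := by
  rw [← Finsupp.range_linearCombination]
  rfl

theorem comb_mem_span (w : ι → V) (c : ι →₀ ℝ) : comb w c ∈ Submodule.span ℝ (Set.range w) := by
  rw [← SetLike.mem_coe, ← range_comb]
  exact ⟨c, rfl⟩

theorem map_comb (f : V →ₗ[ℝ] W) (w : ι → V) (c : ι →₀ ℝ) :
    f (comb w c) = comb (fun r => f (w r)) c :=
  Finsupp.apply_linearCombination ℝ f w c

theorem continuous_comb (c : ι →₀ ℝ) : Continuous fun w : ι → V => comb w c := by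
  simp only [comb, Finsupp.linearCombination_apply, Finsupp.sum]
  fun_prop

/-- The closed linear span of a family. -/
abbrev closedSpan (w : ι → V) : Submodule ℝ V := (Submodule.span ℝ (Set.range w)).topologicalClosure

theorem mem_closedSpan (w : ι → V) (r : ι) : w r ∈ closedSpan w :=
  Submodule.le_topologicalClosure _ (Submodule.subset_span ⟨r, rfl⟩)

theorem comb_mem_closedSpan (w : ι → V) (c : ι →₀ ℝ) : comb w c ∈ closedSpan w :=
  Submodule.le_topologicalClosure _ (comb_mem_span w c)

/-- Linear combinations as elements of the closed span. -/
def combClosedSpan (w : ι → V) : (ι →₀ ℝ) →ₗ[ℝ] closedSpan w :=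
  (Finsupp.linearCombination ℝ w).codRestrict (closedSpan w) (comb_mem_closedSpan w)

theorem denseRange_combClosedSpan (w : ι → V) : DenseRange (combClosedSpan w) := by
  rintro ⟨v, hv⟩
  rw [Topology.IsInducing.subtypeVal.closure_eq_preimage_closure_image, Set.mem_preimage]
  refine closure_mono ?_ hv
  intro u hu
  obtain ⟨c, rfl⟩ : u ∈ Set.range (comb w) := (range_comb w).symm ▸ hu
  exact ⟨combClosedSpan w c, ⟨c, rfl⟩, rfl⟩

/-- Families with the same norms of linear combinations have isometric closed spans. -/
theorem exists_closedSpan_isometry [CompleteSpace V] [CompleteSpace W] (x : ι → V) (y : ι → W)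
    (h : ∀ c, ‖comb y c‖ = ‖comb x c‖) :
    ∃ f : closedSpan x ≃ₗᵢ[ℝ] closedSpan y, ∀ r, (f ⟨x r, mem_closedSpan x r⟩ : W) = y r := by
  have h' : ∀ c, ‖combClosedSpan y (LinearEquiv.refl ℝ (ι →₀ ℝ) c)‖ = ‖combClosedSpan x c‖ := h
  refine ⟨(LinearEquiv.refl ℝ (ι →₀ ℝ)).extendOfIsometry (combClosedSpan x) (combClosedSpan y)
    (denseRange_combClosedSpan x) (denseRange_combClosedSpan y) h', fun r => ?_⟩
  have h1 : (⟨x r, mem_closedSpan x r⟩ : closedSpan x) =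
      combClosedSpan x (Finsupp.single r 1) :=
    Subtype.ext (by simp [combClosedSpan])
  rw [h1, LinearEquiv.extendOfIsometry_eq]
  simp [combClosedSpan]

/-- An isometry onto the closed span of `w` is determined by the preimages of `w`. -/
theorem closedSpan_eq_top_of_range (w : ι → V) (y : ι → W) (ψ : W →ₗᵢ[ℝ] V)
    (hψ : Set.range ψ ⊆ closedSpan w) (hy : ∀ r, ψ (y r) = w r) :
    closedSpan y = ⊤ := by
  rw [eq_top_iff]
  intro v _
  rw [← SetLike.mem_coe, Submodule.topologicalClosure_coe,
    ψ.isometry.isEmbedding.isInducing.closure_eq_preimage_closure_image, Set.mem_preimage,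
    ← ψ.coe_toLinearMap, ← Submodule.map_coe, Submodule.map_span, ← Set.range_comp]
  have : (ψ.toLinearMap ∘ y) = w := funext hy
  rw [this]
  exact hψ ⟨v, rfl⟩

end Span

/-! ### Almost isometric embeddings into `ℓ_∞^d` -/

section Fits

variable {ι : Type*} {V W : Type*} [NormedAddCommGroup V] [NormedSpace ℝ V]
  [NormedAddCommGroup W] [NormedSpace ℝ W]

/-- `v_r ↦ h_r` extends to an isomorphism `T` of the spans with `‖s‖ ≤ ‖T s‖ ≤ (1 + ε) ‖s‖`. -/
def Fits (ε : ℝ) (h : ι → V) (v : ι → W) : Prop :=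
  ∀ c, ‖comb v c‖ ≤ ‖comb h c‖ ∧ ‖comb h c‖ ≤ (1 + ε) * ‖comb v c‖

/-- Only norms of combinations of `h` enter, so the condition may be tested in E_k or in any ambient
space containing it isometrically. -/
theorem fits_comp {U : Type*} [NormedAddCommGroup U] [NormedSpace ℝ U] (ε : ℝ) (J : V →ₗᵢ[ℝ] U)
    (h : ι → V) (v : ι → W) : Fits ε (fun r => J (h r)) v ↔ Fits ε h v := by
  have : ∀ c, ‖comb (fun r => J (h r)) c‖ = ‖comb h c‖ := fun c => by
    rw [← J.norm_map, ← J.coe_toLinearMap, map_comb]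
  simp only [Fits, this]

theorem Fits.norm_le {ε : ℝ} {h : ι → V} {v : ι → W} (hf : Fits ε h v) (r : ι) :
    ‖v r‖ ≤ ‖h r‖ := by
  simpa using (hf (Finsupp.single r 1)).1

theorem Fits.exists_equiv {ε : ℝ} {h : ι → V} {v : ι → W} (hf : Fits ε h v)
    {S : Submodule ℝ W} {H : Submodule ℝ V} (hS : Submodule.span ℝ (Set.range v) = S)
    (hH : Submodule.span ℝ (Set.range h) = H) :
    ∃ T : S ≃ₗ[ℝ] H, (∀ s, ‖s‖ ≤ ‖T s‖ ∧ ‖T s‖ ≤ (1 + ε) * ‖s‖) ∧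
      ∀ c (hc : comb v c ∈ S), (T ⟨comb v c, hc⟩ : V) = comb h c := by
  rw [← Finsupp.range_linearCombination] at hS hH
  subst hS hH
  -- The two inequalities force the families to satisfy the same linear relations, so T comes from
  -- the first isomorphism theorem applied to both.
  have hker : LinearMap.ker (Finsupp.linearCombination ℝ v) =
      LinearMap.ker (Finsupp.linearCombination ℝ h) := by
    ext c
    rw [LinearMap.mem_ker, LinearMap.mem_ker, ← norm_eq_zero (a := Finsupp.linearCombination ℝ v c),
      ← norm_eq_zero (a := Finsupp.linearCombination ℝ h c)]
    constructor
    · intro h0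
      have := (hf c).2
      rw [h0, mul_zero] at this
      exact le_antisymm this (norm_nonneg _)
    · intro h0
      have := (hf c).1
      rw [h0] at this
      exact le_antisymm this (norm_nonneg _)
  let T := ((Finsupp.linearCombination ℝ v).quotKerEquivRange.symm.trans
    (Submodule.quotEquivOfEq _ _ hker)).trans (Finsupp.linearCombination ℝ h).quotKerEquivRange
  have hT : ∀ c (hc : comb v c ∈ LinearMap.range (Finsupp.linearCombination ℝ v)),
      (T ⟨comb v c, hc⟩ : V) = comb h c := by
    intro c hc
    have : (⟨comb v c, hc⟩ : LinearMap.range (Finsupp.linearCombination ℝ v)) =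
      (Finsupp.linearCombination ℝ v).quotKerEquivRange (Submodule.Quotient.mk c) := rfl
    rw [this]
    simp only [T, LinearEquiv.trans_apply, LinearEquiv.symm_apply_apply,
      Submodule.quotEquivOfEq_mk, LinearMap.quotKerEquivRange_apply_mk]
  refine ⟨T, ?_, hT⟩
  rintro ⟨_, c, rfl⟩
  have := hT c ⟨c, rfl⟩
  change ‖comb v c‖ ≤ ‖(T ⟨comb v c, ⟨c, rfl⟩⟩ : V)‖ ∧
    ‖(T ⟨comb v c, ⟨c, rfl⟩⟩ : V)‖ ≤ (1 + ε) * ‖comb v c‖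
  rw [this]
  exact hf c

theorem comb_equiv_symm {h : ι → V} {S : Submodule ℝ W} {H : Submodule ℝ V} (T : S ≃ₗ[ℝ] H)
    (hmem : ∀ r, h r ∈ H) (c : ι →₀ ℝ) :
    ∃ hc : comb h c ∈ H,
      comb (fun r => (T.symm ⟨h r, hmem r⟩ : W)) c = T.symm ⟨comb h c, hc⟩ := by
  have h2 : comb h c = (comb (fun r => (⟨h r, hmem r⟩ : H)) c : H) := by
    rw [← H.subtype_apply, map_comb]
    rfl
  refine ⟨h2 ▸ (comb (fun r => (⟨h r, hmem r⟩ : H)) c).2, ?_⟩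
  have h3 : ∀ hc : comb h c ∈ H,
      (⟨comb h c, hc⟩ : H) = comb (fun r => (⟨h r, hmem r⟩ : H)) c := fun _ => Subtype.ext h2
  rw [h3, ← LinearEquiv.coe_toLinearMap, map_comb, ← S.subtype_apply, map_comb]
  rfl

theorem fits_equiv_symm {ε : ℝ} {h : ι → V} {S : Submodule ℝ W} {H : Submodule ℝ V}
    (T : S ≃ₗ[ℝ] H) (hT : ∀ s, ‖s‖ ≤ ‖T s‖ ∧ ‖T s‖ ≤ (1 + ε) * ‖s‖) (hmem : ∀ r, h r ∈ H) :
    Fits ε h fun r => (T.symm ⟨h r, hmem r⟩ : W) := by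
  intro c
  obtain ⟨hc, h1⟩ := comb_equiv_symm T hmem c
  have := hT (T.symm ⟨comb h c, hc⟩)
  rw [LinearEquiv.apply_symm_apply] at this
  rw [h1]
  exact this

/-- Trades the quantifiers over subspaces S and isomorphisms T for one over families of vectors,
which form a topological space. -/
theorem almostEmbeds_iff {V : Type} [NormedAddCommGroup V] [NormedSpace ℝ V] {ε : ℝ} {d : ℕ}
    {h : ι → V} {H : Submodule ℝ V} (hH : Submodule.span ℝ (Set.range h) = H) :
    AlmostEmbeds ε d H ↔ ∃ v : ι → Fin d → ℝ, Fits ε h v := by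
  constructor
  · rintro ⟨S, T, hT⟩
    exact ⟨_, fits_equiv_symm T hT fun r => hH ▸ Submodule.subset_span ⟨r, rfl⟩⟩
  · rintro ⟨v, hv⟩
    obtain ⟨T, hT, -⟩ := hv.exists_equiv rfl hH
    exact ⟨_, T, hT⟩

/-- Compactness: fitting forces ‖v_r‖ ≤ ‖h_r‖, so v_r = ‖h_r‖ w_r with w in a product of closed unit
balls of ℝ^d. That product is compact, and projection along a compact factor is a closed map. -/
theorem isClosed_setOf_exists_fits (ε : ℝ) (d : ℕ) :
    IsClosed {h : ι → V | ∃ v : ι → Fin d → ℝ, Fits ε h v} := by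
  let K : Set (ι → Fin d → ℝ) := Set.pi Set.univ fun _ => Metric.closedBall 0 1
  have hK : IsCompact K := isCompact_univ_pi fun _ => isCompact_closedBall _ _
  have : CompactSpace K := isCompact_iff_compactSpace.mp hK
  have hC : IsClosed {p : K × (ι → V) | Fits ε p.2 (fun r => ‖p.2 r‖ • p.1.1 r)} := by
    simp only [Fits, Set.ofPred_forall, Set.ofPred_and]
    have h1 : ∀ c, Continuous fun p : K × (ι → V) => comb (fun r => ‖p.2 r‖ • p.1.1 r) c :=
      fun c => (continuous_comb c).comp (continuous_pi fun r =>
        ((continuous_apply r).comp continuous_snd).norm.smul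
          ((continuous_apply r).comp (continuous_subtype_val.comp continuous_fst)))
    have h2 : ∀ c, Continuous fun p : K × (ι → V) => comb p.2 c :=
      fun c => (continuous_comb c).comp continuous_snd
    exact isClosed_iInter fun c => (isClosed_le (h1 c).norm (h2 c).norm).inter
      (isClosed_le (h2 c).norm (continuous_const.mul (h1 c).norm))
  convert isClosedMap_snd_of_compactSpace _ hC using 1
  ext h
  constructor
  · rintro ⟨v, hv⟩
    -- If h_r = 0 then v_r = 0 as well, so the convention 0⁻¹ = 0 does no harm.
    have hw : ∀ r, ‖h r‖ • (‖h r‖⁻¹ • v r) = v r := by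
      intro r
      by_cases h0 : ‖h r‖ = 0
      · have := hv.norm_le r
        rw [h0] at this
        rw [norm_le_zero_iff.1 this]
        simp
      · exact smul_inv_smul₀ h0 _
    refine ⟨⟨⟨fun r => ‖h r‖⁻¹ • v r, fun r _ => ?_⟩, h⟩, ?_, rfl⟩
    · rw [mem_closedBall_zero_iff, norm_smul, norm_inv, norm_norm]
      exact (mul_le_mul_of_nonneg_left (hv.norm_le r) (by positivity)).trans inv_mul_le_one
    · change Fits ε h fun r => ‖h r‖ • (‖h r‖⁻¹ • v r)
      simpa only [hw] using hv
  · rintro ⟨⟨w, h⟩, hw, rfl⟩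
    exact ⟨_, hw⟩

end Fits

/-- Finite-dimensional normed spaces embed almost isometrically into `ℓ_∞^d` for large `d`. -/
theorem exists_almostEmbeds (ε : ℝ) (hε : 0 < ε) (H : Type) [NormedAddCommGroup H]
    [NormedSpace ℝ H] [FiniteDimensional ℝ H] (k : ℕ) : ∃ d, k ≤ d ∧ AlmostEmbeds ε d H := by
  have : ProperSpace H := FiniteDimensional.proper_real H
  -- The radius δ of the net solves (1 + ε)(1 - δ) = 1: a functional norming a net point within δ of
  -- a unit vector x is at least 1 - δ at x.
  have hδ : 0 < ε / (1 + ε) := by positivity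
  choose φ hφ hφx using fun x : H => exists_dual_vector'' ℝ x
  obtain ⟨t, hts, htf, ht⟩ := (isCompact_sphere (0 : H) 1).elim_finite_subcover_image
    (b := Metric.sphere (0 : H) 1) (c := fun x => Metric.ball x (ε / (1 + ε)))
    (fun _ _ => Metric.isOpen_ball)
    (fun x hx => Set.mem_biUnion hx (Metric.mem_ball_self hδ))
  let s := htf.toFinset
  let f : ℕ → StrongDual ℝ H := fun i =>
    if hi : i < s.card then φ (s.equivFin.symm ⟨i, hi⟩) else 0
  have hf : ∀ i, ‖f i‖ ≤ 1 := by
    intro i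
    simp only [f]
    split_ifs
    · exact hφ _
    · simp
  -- Coordinates beyond the net carry the zero functional, so d can be raised to k without affecting
  -- the estimates.
  let d := max k s.card
  let R : H →ₗ[ℝ] (Fin d → ℝ) := LinearMap.pi fun i => (f i : H →ₗ[ℝ] ℝ)
  have hR1 : ∀ x, ‖R x‖ ≤ ‖x‖ := by
    intro x
    refine (pi_norm_le_iff_of_nonneg (norm_nonneg x)).2 fun i => ?_
    calc ‖f i x‖ ≤ ‖f i‖ * ‖x‖ := (f i).le_opNorm x
      _ ≤ 1 * ‖x‖ := by gcongr; exact hf i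
      _ = ‖x‖ := one_mul _
  have hsph : ∀ x : H, ‖x‖ = 1 → 1 ≤ (1 + ε) * ‖R x‖ := by
    intro x hx
    obtain ⟨y, hy, hxy⟩ := Set.mem_iUnion₂.1 (ht (mem_sphere_zero_iff_norm.2 hx))
    have hys : y ∈ s := htf.mem_toFinset.2 hy
    let i := s.equivFin ⟨y, hys⟩
    have hfi : f i = φ y := by
      have h1 := i.2
      simp only [f, h1, dif_pos, i, Fin.eta, Equiv.symm_apply_apply]
    have h1 : ‖f i x‖ ≤ ‖R x‖ := norm_le_pi_norm (R x) ⟨i, lt_of_lt_of_le i.2 (le_max_right _ _)⟩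
    have h2 : ‖x - y‖ < ε / (1 + ε) := mem_ball_iff_norm.1 hxy
    have h3 : ‖φ y (x - y)‖ ≤ ‖x - y‖ := by
      calc ‖φ y (x - y)‖ ≤ ‖φ y‖ * ‖x - y‖ := (φ y).le_opNorm _
        _ ≤ 1 * ‖x - y‖ := by gcongr; exact hφ y
        _ = _ := one_mul _
    have h4 : ‖y‖ = 1 := mem_sphere_zero_iff_norm.1 (hts hy)
    have h5 : φ y x = 1 + φ y (x - y) := by
      rw [map_sub, hφx, h4]
      simp
    rw [hfi, h5, Real.norm_eq_abs] at h1
    rw [Real.norm_eq_abs] at h3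
    have h6 : 1 - ε / (1 + ε) ≤ ‖R x‖ := by
      have := le_abs_self (1 + φ y (x - y))
      have := neg_abs_le (φ y (x - y))
      linarith
    have h7 : (1 + ε) * (1 - ε / (1 + ε)) = 1 := by
      field_simp
      ring
    calc 1 = (1 + ε) * (1 - ε / (1 + ε)) := h7.symm
      _ ≤ _ := by gcongr
  have hR2 : ∀ x, ‖x‖ ≤ (1 + ε) * ‖R x‖ := by
    intro x
    by_cases h0 : x = 0
    · simp [h0]
    have h1 : 0 < ‖x‖ := norm_pos_iff.2 h0
    have := hsph (‖x‖⁻¹ • x) (by rw [norm_smul, norm_inv, norm_norm, inv_mul_cancel₀ h1.ne'])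
    rw [map_smul, norm_smul, norm_inv, norm_norm] at this
    calc ‖x‖ = ‖x‖ * 1 := (mul_one _).symm
      _ ≤ ‖x‖ * ((1 + ε) * (‖x‖⁻¹ * ‖R x‖)) := by gcongr
      _ = _ := by field_simp
  have hinj : Function.Injective R := by
    rw [← LinearMap.ker_eq_bot, LinearMap.ker_eq_bot']
    intro x hx
    have := hR2 x
    rw [hx, norm_zero, mul_zero] at this
    exact norm_le_zero_iff.1 this
  refine ⟨d, le_max_left _ _, _, (LinearEquiv.ofInjective R hinj).symm, ?_⟩
  rintro ⟨_, x, rfl⟩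
  have : (LinearEquiv.ofInjective R hinj).symm ⟨R x, ⟨x, rfl⟩⟩ = x := by
    rw [LinearEquiv.symm_apply_eq]
    rfl
  rw [this]
  exact ⟨hR1 x, hR2 x⟩

/-! ### The inductive limit -/

section IndLimit

variable {E : ℕ → Type} [∀ n, NormedAddCommGroup (E n)] [∀ n, NormedSpace ℝ (E n)]
  (j : ∀ n, E n →ₗᵢ[ℝ] E (n + 1))

theorem pushSeq_self (n : ℕ) (x : E n) : (pushSeq j n x).1 n = x := by
  simp only [pushSeq, le_refl, dif_pos]
  exact Nat.leRecOn_self _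

theorem pushSeq_succ {n m : ℕ} (h : n ≤ m) (x : E n) :
    (pushSeq j n x).1 (m + 1) = j m ((pushSeq j n x).1 m) := by
  simp only [pushSeq, dif_pos h, dif_pos (Nat.le_succ_of_le h)]
  exact Nat.leRecOn_succ h _

/-- The limit seminorm ignores finitely many terms, and the completion identifies points at distance
zero. -/
theorem coe_eq_of_eventually {x y : PreLimit j} (h : ∀ᶠ n in atTop, x.1 n = y.1 n) :
    (x : IndLimit j) = (y : IndLimit j) := by
  rw [← dist_eq_zero, UniformSpace.Completion.dist_eq, dist_eq_norm]
  refine tendsto_nhds_unique (tendsto_preNorm j (x - y)) ?_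
  refine tendsto_const_nhds.congr' ?_
  filter_upwards [h] with n hn
  have : (x - y).1 n = x.1 n - y.1 n := rfl
  rw [this, hn, sub_self, norm_zero]

theorem coe_eq_toIndLimit (z : PreLimit j) {N : ℕ}
    (hN : ∀ n ≥ N, j n (z.1 n) = z.1 (n + 1)) :
    (z : IndLimit j) = toIndLimit j N (z.1 N) := by
  refine coe_eq_of_eventually j (eventually_atTop.2 ⟨N, fun n hn => ?_⟩)
  induction n, hn using Nat.le_induction with
  | base => rw [pushSeq_self]
  | succ n hn ih => rw [pushSeq_succ j hn, ← hN n hn, ih]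

theorem toIndLimit_succ (n : ℕ) (x : E n) :
    toIndLimit j (n + 1) (j n x) = toIndLimit j n x := by
  have := coe_eq_toIndLimit j (pushSeq j n x) (N := n + 1)
    (fun m hm => (pushSeq_succ j (Nat.le_of_succ_le hm) x).symm)
  rw [pushSeq_succ j le_rfl, pushSeq_self] at this
  exact this.symm

/-- The canonical embedding `J_n` as a linear isometry. -/
def toIndLimitₗᵢ (n : ℕ) : E n →ₗᵢ[ℝ] IndLimit j where
  toFun := toIndLimit j n
  map_add' x y := by
    have h := coe_eq_toIndLimit j (pushSeq j n x + pushSeq j n y) (N := n) (fun m hm => by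
      change j m ((pushSeq j n x).1 m + (pushSeq j n y).1 m) =
        (pushSeq j n x).1 (m + 1) + (pushSeq j n y).1 (m + 1)
      rw [map_add, pushSeq_succ j hm, pushSeq_succ j hm])
    have h2 : (pushSeq j n x + pushSeq j n y).1 n = x + y := by
      change (pushSeq j n x).1 n + (pushSeq j n y).1 n = x + y
      rw [pushSeq_self, pushSeq_self]
    rw [h2] at h
    rw [← h]
    exact UniformSpace.Completion.coe_add _ _
  map_smul' c x := by
    have h := coe_eq_toIndLimit j (c • pushSeq j n x) (N := n) (fun m hm => by
      change j m (c • (pushSeq j n x).1 m) = c • (pushSeq j n x).1 (m + 1)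
      rw [map_smul, pushSeq_succ j hm])
    have h2 : (c • pushSeq j n x).1 n = c • x := by
      change c • (pushSeq j n x).1 n = c • x
      rw [pushSeq_self]
    rw [h2] at h
    rw [← h]
    exact UniformSpace.Completion.coe_smul _ _
  norm_map' x := by
    change ‖((pushSeq j n x : PreLimit j) : IndLimit j)‖ = ‖x‖
    rw [UniformSpace.Completion.norm_coe]
    refine tendsto_nhds_unique (tendsto_preNorm j _) (tendsto_const_nhds.congr' ?_)
    refine eventually_atTop.2 ⟨n, fun m hm => ?_⟩
    change ‖x‖ = ‖(pushSeq j n x).1 m‖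
    induction m, hm using Nat.le_induction with
    | base => rw [pushSeq_self]
    | succ m hm ih => rw [pushSeq_succ j hm, LinearIsometry.norm_map, ← ih]

theorem exists_coe_eq_toIndLimit (z : PreLimit j) :
    ∃ n x, (z : IndLimit j) = toIndLimit j n x := by
  obtain ⟨N, hN⟩ := eventually_atTop.1 z.2
  exact ⟨N, _, coe_eq_toIndLimit j z hN⟩

theorem dense_iUnion_range_toIndLimit : Dense (⋃ n, Set.range (toIndLimit j n)) := by
  refine (UniformSpace.Completion.denseRange_coe (α := PreLimit j)).mono ?_
  rintro _ ⟨z, rfl⟩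
  obtain ⟨n, x, h⟩ := exists_coe_eq_toIndLimit j z
  exact Set.mem_iUnion.2 ⟨n, x, h.symm⟩

theorem separableSpace_indLimit (h : ∀ n, TopologicalSpace.SeparableSpace (E n)) :
    TopologicalSpace.SeparableSpace (IndLimit j) := by
  have h1 : TopologicalSpace.IsSeparable (⋃ n, Set.range (toIndLimit j n)) :=
    TopologicalSpace.IsSeparable.iUnion fun n =>
      TopologicalSpace.isSeparable_range (toIndLimitₗᵢ j n).continuous
  rw [← TopologicalSpace.isSeparable_univ_iff, ← (dense_iUnion_range_toIndLimit j).closure_eq]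
  exact h1.closure

/-- The universal property of the inductive limit. -/
theorem exists_linearIsometry_indLimit {V : Type*} [NormedAddCommGroup V] [NormedSpace ℝ V]
    [CompleteSpace V] (J : ∀ n, E n →ₗᵢ[ℝ] V) (hJ : ∀ n x, J (n + 1) (j n x) = J n x) :
    ∃ Ψ : IndLimit j →ₗᵢ[ℝ] V, ∀ n x, Ψ (toIndLimit j n x) = J n x := by
  -- The sequence J_n(z_n) is eventually constant; its limit defines an isometry on the pre-limit,
  -- which then extends to the completion.
  have hlim : ∀ z : PreLimit j, ∃ v, Tendsto (fun n => J n (z.1 n)) atTop (𝓝 v) := by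
    intro z
    obtain ⟨N, hN⟩ := eventually_atTop.1 z.2
    refine ⟨J N (z.1 N), tendsto_const_nhds.congr' (eventually_atTop.2 ⟨N, fun n hn => ?_⟩)⟩
    change J N (z.1 N) = J n (z.1 n)
    induction n, hn using Nat.le_induction with
    | base => rfl
    | succ n hn ih => rw [ih, ← hN n hn, hJ]
  choose f hf using hlim
  let fl : PreLimit j →ₗ[ℝ] V :=
    { toFun := f
      map_add' := fun x y => tendsto_nhds_unique (hf (x + y))
        (((hf x).add (hf y)).congr fun n => ((J n).map_add _ _).symm)
      map_smul' := fun c x => tendsto_nhds_unique (hf (c • x))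
        (((hf x).const_smul c).congr fun n => ((J n).map_smul _ _).symm) }
  have hnorm : ∀ z, ‖f z‖ = ‖z‖ := fun z =>
    tendsto_nhds_unique (hf z).norm
      ((tendsto_preNorm j z).congr fun n => ((J n).norm_map _).symm)
  let fi : PreLimit j →ₗᵢ[ℝ] V := ⟨fl, hnorm⟩
  have hext : ∀ z : PreLimit j, fi.toContinuousLinearMap.extend
      (UniformSpace.Completion.toComplL (𝕜 := ℝ) (E := PreLimit j)) (z : IndLimit j) = f z := by
    intro z
    exact ContinuousLinearMap.extend_eq _ UniformSpace.Completion.denseRange_coe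
      (UniformSpace.Completion.isUniformInducing_coe _) z
  refine ⟨⟨(fi.toContinuousLinearMap.extend
    (UniformSpace.Completion.toComplL (𝕜 := ℝ) (E := PreLimit j))).toLinearMap, ?_⟩, ?_⟩
  · intro z
    induction z using UniformSpace.Completion.induction_on with
    | hp => exact isClosed_eq (ContinuousLinearMap.continuous _).norm continuous_norm
    | ih z =>
      rw [UniformSpace.Completion.norm_coe, ← hnorm z]
      exact congrArg norm (hext z)
  · intro n x
    refine (hext _).trans (tendsto_nhds_unique (hf _) ?_)
    refine tendsto_const_nhds.congr' (eventually_atTop.2 ⟨n, fun m hm => ?_⟩)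
    change J n x = J m ((pushSeq j n x).1 m)
    induction m, hm using Nat.le_induction with
    | base => rw [pushSeq_self]
    | succ m hm ih => rw [ih, pushSeq_succ j hm, hJ]

end IndLimit

/-! ### The canonical triple: norm formula and embeddings -/

theorem norm_toLp_prod {B X : Type} [NormedAddCommGroup B] [NormedAddCommGroup X] (b : B) (x : X) :
    ‖(WithLp.toLp 1 (b, x) : WithLp 1 (B × X))‖ = ‖b‖ + ‖x‖ :=
  WithLp.prod_norm_eq_of_L1 _

section Triple

variable {B X : Type} [NormedAddCommGroup B] [NormedSpace ℝ B]
  [NormedAddCommGroup X] [NormedSpace ℝ X] (S : Submodule ℝ B) (u : S →ₗ[ℝ] X)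

/-- The class `Q(b, x)`. -/
def kisliakovMk (b : B) (x : X) : Kisliakov S u := Submodule.Quotient.mk (WithLp.toLp 1 (b, x))

theorem kisliakovMk_eq_iff {b b' : B} {x x' : X} :
    kisliakovMk S u b x = kisliakovMk S u b' x' ↔ ∃ s : S, b = b' + s ∧ x = x' - u s := by
  rw [kisliakovMk, kisliakovMk, Submodule.Quotient.eq]
  constructor
  · rintro ⟨s, hs⟩
    have h := congrArg WithLp.ofLp hs
    rw [WithLp.ofLp_sub, Prod.mk_sub_mk, Prod.mk.injEq] at h
    exact ⟨s, by rw [← h.1]; abel, by rw [sub_eq_add_neg x', ← h.2]; abel⟩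
  · rintro ⟨s, rfl, rfl⟩
    refine ⟨s, ?_⟩
    rw [← WithLp.toLp_sub, Prod.mk_sub_mk]
    congr 2 <;> abel

theorem norm_kisliakovMk_le (b : B) (x : X) (s : S) :
    ‖kisliakovMk S u b x‖ ≤ ‖b + s‖ + ‖x - u s‖ := by
  have : kisliakovMk S u (b + s) (x - u s) = kisliakovMk S u b x :=
    (kisliakovMk_eq_iff S u).2 ⟨s, rfl, rfl⟩
  rw [← this, ← norm_toLp_prod]
  exact Submodule.Quotient.norm_mk_le _ _

/-- With `norm_kisliakovMk_le` this says that the quotient norm is the infimum of ‖b + s‖ + ‖x -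
u(s)‖ over s ∈ S, in the form of near-minimisers. -/
theorem exists_lt_norm_kisliakovMk (b : B) (x : X) {δ : ℝ} (hδ : 0 < δ) :
    ∃ s : S, ‖b + s‖ + ‖x - u s‖ < ‖kisliakovMk S u b x‖ + δ := by
  obtain ⟨⟨b', x'⟩, hm, hlt⟩ := Submodule.Quotient.norm_mk_lt (kisliakovMk S u b x) hδ
  obtain ⟨s, rfl, rfl⟩ := (kisliakovMk_eq_iff S u).1 hm
  exact ⟨s, by rwa [← norm_toLp_prod]⟩

theorem kisliakovMk_surjective (z : Kisliakov S u) : ∃ b x, kisliakovMk S u b x = z := by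
  obtain ⟨⟨b, x⟩, rfl⟩ := Submodule.Quotient.mk_surjective _ z
  exact ⟨b, x, rfl⟩

theorem kisliakovMk_add (b b' : B) (x x' : X) :
    kisliakovMk S u (b + b') (x + x') = kisliakovMk S u b x + kisliakovMk S u b' x' := rfl

theorem kisliakovMk_smul (c : ℝ) (b : B) (x : X) :
    kisliakovMk S u (c • b) (c • x) = c • kisliakovMk S u b x := rfl

/-- `ũ` as a linear map. -/
def kisliakovUₗ : B →ₗ[ℝ] Kisliakov S u where
  toFun := kisliakovU S u
  map_add' b b' := by
    have := kisliakovMk_add S u b b' 0 0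
    rwa [add_zero] at this
  map_smul' c b := by
    have := kisliakovMk_smul S u c b 0
    rwa [smul_zero] at this

theorem norm_kisliakovU_le (b : B) : ‖kisliakovU S u b‖ ≤ ‖b‖ :=
  (norm_kisliakovMk_le S u b 0 0).trans_eq (by simp)

/-- `j` as a linear isometry. -/
def kisliakovJₗᵢ (hu : ∀ s, ‖u s‖ ≤ ‖s‖) : X →ₗᵢ[ℝ] Kisliakov S u where
  toFun := kisliakovJ S u
  map_add' x x' := by
    have := kisliakovMk_add S u 0 0 x x'
    rwa [add_zero] at this
  map_smul' c x := by
    have := kisliakovMk_smul S u c 0 x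
    rwa [smul_zero] at this
  norm_map' x := by
    refine le_antisymm ((norm_kisliakovMk_le S u 0 x 0).trans_eq (by simp))
      (le_of_forall_pos_le_add fun δ hδ => ?_)
    obtain ⟨s, hs⟩ := exists_lt_norm_kisliakovMk S u 0 x hδ
    refine le_trans ?_ hs.le
    rw [zero_add]
    calc ‖x‖ = ‖u s + (x - u s)‖ := by rw [add_sub_cancel]
      _ ≤ ‖u s‖ + ‖x - u s‖ := norm_add_le _ _
      _ ≤ ‖(s : B)‖ + ‖x - u s‖ := by gcongr; exact hu s

/-- N is a linear image of the finite-dimensional space S. Closedness is what turns the quotient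
seminorm into a norm. -/
theorem isClosed_kisliakovN [FiniteDimensional ℝ S] :
    IsClosed (kisliakovN S u : Set (WithLp 1 (B × X))) := by
  let f : S →ₗ[ℝ] WithLp 1 (B × X) :=
    (WithLp.linearEquiv 1 ℝ (B × X)).symm.toLinearMap ∘ₗ (S.subtype.prod (-u))
  have : kisliakovN S u = LinearMap.range f := by
    ext z
    exact ⟨fun ⟨s, hs⟩ => ⟨s, hs.symm⟩, fun ⟨s, hs⟩ => ⟨s, hs.symm⟩⟩
  rw [this]
  exact Submodule.closed_of_finiteDimensional _

/-- The canonical triple is determined by its norm formula: it is realised by a pair of maps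
`g` and `J` with the same formula. -/
theorem exists_kisliakov_equiv [FiniteDimensional ℝ S] {V : Type*} [NormedAddCommGroup V]
    [NormedSpace ℝ V] (J : X →ₗᵢ[ℝ] V) (g : B →ₗ[ℝ] V) (hg : ∀ b, ‖g b‖ ≤ ‖b‖)
    (hgu : ∀ s : S, g s = J (u s))
    (hinf : ∀ (b : B) (x : X), ∀ δ > 0, ∃ s : S, ‖b + s‖ + ‖x - u s‖ < ‖g b + J x‖ + δ)
    (E' : Submodule ℝ V) (hE' : E' = LinearMap.range J.toLinearMap ⊔ LinearMap.range g) :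
    ∃ Φ : Kisliakov S u ≃ₗᵢ[ℝ] E', ∀ b x, (Φ (kisliakovMk S u b x) : V) = g b + J x := by
  let f₀ : WithLp 1 (B × X) →ₗ[ℝ] V :=
    (g.coprod J.toLinearMap) ∘ₗ (WithLp.linearEquiv 1 ℝ (B × X)).toLinearMap
  have hf₀ : ∀ b x, f₀ (WithLp.toLp 1 (b, x)) = g b + J x := fun _ _ => rfl
  have hker : kisliakovN S u ≤ LinearMap.ker f₀ := by
    rintro _ ⟨s, rfl⟩
    rw [LinearMap.mem_ker, hf₀, map_neg, hgu, add_neg_cancel]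
  have hmem : ∀ z, (kisliakovN S u).liftQ f₀ hker z ∈ E' := by
    intro z
    obtain ⟨b, x, rfl⟩ := kisliakovMk_surjective S u z
    rw [hE']
    change g b + J x ∈ _
    rw [add_comm]
    exact Submodule.add_mem_sup ⟨x, rfl⟩ ⟨b, rfl⟩
  let f : Kisliakov S u →ₗ[ℝ] E' := ((kisliakovN S u).liftQ f₀ hker).codRestrict E' hmem
  have hf : ∀ b x, (f (kisliakovMk S u b x) : V) = g b + J x := fun _ _ => rfl
  have hnorm : ∀ z, ‖f z‖ = ‖z‖ := by
    intro z
    obtain ⟨b, x, rfl⟩ := kisliakovMk_surjective S u z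
    rw [Submodule.coe_norm, hf]
    -- One inequality uses that `g` is contractive and agrees with `J ∘ u` on S; the other is the
    -- hypothesis `hinf`.
    refine le_antisymm (le_of_forall_pos_le_add fun δ hδ => ?_)
      (le_of_forall_pos_le_add fun δ hδ => ?_)
    · obtain ⟨s, hs⟩ := exists_lt_norm_kisliakovMk S u b x hδ
      refine le_trans ?_ hs.le
      have : g b + J x = g (b + s) + J (x - u s) := by
        rw [map_add, map_sub, hgu]
        abel
      rw [this]
      exact (norm_add_le _ _).trans (add_le_add (hg _) (J.norm_map _).le)
    · obtain ⟨s, hs⟩ := hinf b x δ hδ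
      exact (norm_kisliakovMk_le S u b x s).trans hs.le
  have hinj : Function.Injective f := by
    rw [← LinearMap.ker_eq_bot, LinearMap.ker_eq_bot']
    intro z hz
    have h0 : ‖z‖ = 0 := by rw [← hnorm, hz, norm_zero]
    let _ : NormedAddCommGroup (Kisliakov S u) :=
      @Submodule.Quotient.normedAddCommGroup _ _ _ _ _ _ (isClosed_kisliakovN S u)
    exact norm_eq_zero.1 h0
  have hsurj : Function.Surjective f := by
    rintro ⟨v, hv⟩
    rw [hE'] at hv
    obtain ⟨_, ⟨x, rfl⟩, _, ⟨b, rfl⟩, rfl⟩ := Submodule.mem_sup.1 hv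
    exact ⟨kisliakovMk S u b x, Subtype.ext (by rw [hf, add_comm]; rfl)⟩
  exact ⟨⟨LinearEquiv.ofBijective f ⟨hinj, hsurj⟩, hnorm⟩, hf⟩

end Triple

/-! ### Existence of the construction -/

section Existence

variable {X : Type} [NormedAddCommGroup X] [NormedSpace ℝ X]

/-- A stage of the construction: the space `E_k`, the embedding of `X` into it and `G_k`. -/
structure Stage (X : Type) [NormedAddCommGroup X] [NormedSpace ℝ X] where
  E : Type
  [grp : NormedAddCommGroup E]
  [spc : NormedSpace ℝ E]
  emb : X →ₗᵢ[ℝ] E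
  G : Submodule ℝ E
  [fin : FiniteDimensional ℝ G]

attribute [instance] Stage.grp Stage.spc Stage.fin

/-- The data produced in the passage from one stage to the next. -/
structure Stage.Step (lam ε : ℝ) (F : Submodule ℝ X) (k : ℕ) (a b : Stage X) where
  j : a.E →ₗᵢ[ℝ] b.E
  emb_eq : b.emb = j.comp a.emb
  H : Submodule ℝ a.E
  H_eq : H = Submodule.span ℝ ((a.emb '' (F : Set X)) ∪ (a.G : Set a.E))
  m : ℕ
  m_least : IsLeast {d | k + 1 ≤ d ∧ AlmostEmbeds ε d H} m
  S : Submodule ℝ (Fin m → ℝ)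
  T : S ≃ₗ[ℝ] H
  T_bound : ∀ (s : S), ‖s‖ ≤ ‖T s‖ ∧ ‖T s‖ ≤ (1 + ε) * ‖s‖
  u : S →ₗ[ℝ] a.E
  u_eq : ∀ (s : S), u s = (1 / lam) • (T s : a.E)
  Φ : Kisliakov S u ≃ₗᵢ[ℝ] b.E
  j_eq : ∀ x, j x = Φ (kisliakovJ S u x)
  G_succ : (b.G : Set b.E) = Set.range (fun b : Fin m → ℝ => Φ (kisliakovU S u b))

/-- This is the contraction estimate ‖u_k(s)‖ ≤ ‖s‖, where 1 + ε ≤ λ enters. -/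
theorem norm_smul_le_of_almostEmbeds {lam ε : ℝ} (hlam : 1 < lam) (hε : 1 + ε ≤ lam) {t s : ℝ}
    (hs : 0 ≤ s) (h : t ≤ (1 + ε) * s) : |1 / lam| * t ≤ s := by
  have hl : 0 < lam := by linarith
  rw [abs_of_pos (by positivity), one_div, inv_mul_le_iff₀ hl]
  exact h.trans (by gcongr)

theorem Stage.exists_step {lam ε : ℝ} (hlam : 1 < lam) (hε : 0 < ε) (hle : 1 + ε ≤ lam)
    (F : Submodule ℝ X) [FiniteDimensional ℝ F] (k : ℕ) (a : Stage X) :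
    ∃ b : Stage X, Nonempty (Stage.Step lam ε F k a b) := by
  let H : Submodule ℝ a.E := Submodule.span ℝ ((a.emb '' (F : Set X)) ∪ (a.G : Set a.E))
  have hH : H = F.map a.emb.toLinearMap ⊔ a.G := by
    simp only [H]
    rw [Submodule.span_union, Submodule.span_eq, ← a.emb.coe_toLinearMap, Submodule.span_image,
      Submodule.span_eq]
  have : FiniteDimensional ℝ H := by
    rw [hH]
    infer_instance
  let P : Set ℕ := {d | k + 1 ≤ d ∧ AlmostEmbeds ε d H}
  have hP : P.Nonempty := exists_almostEmbeds ε hε H (k + 1)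
  have hm : IsLeast P (sInf P) := ⟨Nat.sInf_mem hP, fun _ h => Nat.sInf_le h⟩
  obtain ⟨S, T, hT⟩ := hm.1.2
  let u : S →ₗ[ℝ] a.E := (1 / lam) • (H.subtype ∘ₗ T.toLinearMap)
  have hu : ∀ s, ‖u s‖ ≤ ‖s‖ := by
    intro s
    change ‖(1 / lam) • (T s : a.E)‖ ≤ ‖s‖
    rw [norm_smul, Real.norm_eq_abs]
    exact norm_smul_le_of_almostEmbeds hlam hle (norm_nonneg s) (hT s).2
  let _ : NormedAddCommGroup (Kisliakov S u) :=
    @Submodule.Quotient.normedAddCommGroup _ _ _ _ _ _ (isClosed_kisliakovN S u)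
  refine ⟨{ E := Kisliakov S u, emb := (kisliakovJₗᵢ S u hu).comp a.emb,
            G := LinearMap.range (kisliakovUₗ S u) }, ⟨?_⟩⟩
  exact
    { j := kisliakovJₗᵢ S u hu
      emb_eq := rfl
      H := H
      H_eq := rfl
      m := sInf P
      m_least := hm
      S := S
      T := T
      T_bound := hT
      u := u
      u_eq := fun _ => rfl
      Φ := LinearIsometryEquiv.refl ℝ _
      j_eq := fun _ => rfl
      G_succ := rfl }

theorem exists_bpSystem {lam ε : ℝ} (hlam : 1 < lam) (hε : 0 < ε) (hle : 1 + ε ≤ lam)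
    (F : ℕ → Submodule ℝ X) (hF : ∀ n, FiniteDimensional ℝ (F n)) :
    Nonempty (BPSystem lam ε F) := by
  choose next hnext using fun (k : ℕ) (a : Stage X) => Stage.exists_step hlam hε hle (F k) k a
  let st : ℕ → Stage X := fun n => Nat.rec
    { E := X, emb := LinearIsometry.id, G := ⊥ } (fun k a => next k a) n
  let step : ∀ k, Stage.Step lam ε (F k) k (st k) (st (k + 1)) := fun k => (hnext k (st k)).some
  -- The embedding of X stored in each stage is the iterated composition of the j_i, so the
  -- stagewise description of H_k is the required one.
  have hemb : ∀ k, @iterEmb (fun n => (st n).E) (fun n => (st n).grp)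
      (fun n => (st n).spc) (fun n => (step n).j) X _ _ (LinearIsometryEquiv.refl ℝ X) k = (st k).emb := by
    intro k
    induction k with
    | zero => rfl
    | succ k ih =>
      rw [(step k).emb_eq, ← ih]
      rfl
  exact ⟨
    { E := fun n => (st n).E
      grp := fun n => (st n).grp
      spc := fun n => (st n).spc
      j := fun n => (step n).j
      G := fun n => (st n).G
      e := LinearIsometryEquiv.refl ℝ X
      G_zero := rfl
      H := fun n => (step n).H
      H_eq := fun k => by rw [hemb]; exact (step k).H_eq
      m := fun k => (step k).m
      m_least := fun k => (step k).m_least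
      S := fun k => (step k).S
      T := fun k => (step k).T
      T_bound := fun k => (step k).T_bound
      u := fun k => (step k).u
      u_eq := fun k => (step k).u_eq
      Φ := fun k => (step k).Φ
      j_eq := fun k => (step k).j_eq
      G_succ := fun k => (step k).G_succ }⟩

end Existence

/-! ### Separability of the stages and the increasing union of the G_n -/

section Limit

variable {X : Type} [NormedAddCommGroup X] [NormedSpace ℝ X] {lam ε : ℝ} {F : ℕ → Submodule ℝ X}

/-- Each E_{n+1} is a continuous image of ℓ_∞^{m_n} × E_n. -/
theorem BPSystem.separableSpace [TopologicalSpace.SeparableSpace X] (P : BPSystem lam ε F) :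
    ∀ n, TopologicalSpace.SeparableSpace (P.E n)
  | 0 => P.e.surjective.denseRange.separableSpace P.e.continuous
  | n + 1 => by
    have := P.separableSpace n
    let f : (Fin (P.m n) → ℝ) × P.E n → P.E (n + 1) := fun p =>
      P.Φ n (kisliakovMk (P.S n) (P.u n) p.1 p.2)
    have hf : Continuous f :=
      (P.Φ n).continuous.comp (((Submodule.mkQL _).continuous).comp (WithLp.prod_continuous_toLp 1 _ _))
    have hs : Function.Surjective f := by
      intro y
      obtain ⟨b, x, h⟩ := kisliakovMk_surjective _ _ ((P.Φ n).symm y)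
      exact ⟨(b, x), by simp [f, h]⟩
    exact hs.denseRange.separableSpace hf

theorem BPSystem.mem_H_of_mem_G (P : BPSystem lam ε F) (k : ℕ) {x : P.E k} (hx : x ∈ P.G k) :
    x ∈ P.H k := by
  rw [P.H_eq]
  exact Submodule.subset_span (Or.inr hx)

/-- `j_k` maps `H_k` into `G_{k+1}`; explicitly `j_k h = λ ũ_k (T_k⁻¹ h)`. -/
theorem BPSystem.j_eq_smul (P : BPSystem lam ε F) (hlam : lam ≠ 0) (k : ℕ) (s : P.S k) :
    P.j k (P.T k s) = lam • P.Φ k (kisliakovU (P.S k) (P.u k) s) := by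
  have h : kisliakovMk (P.S k) (P.u k) s 0 = kisliakovMk (P.S k) (P.u k) 0 (P.u k s) :=
    (kisliakovMk_eq_iff _ _).2 ⟨s, by simp, by simp⟩
  have h2 : P.Φ k (kisliakovU (P.S k) (P.u k) s) = P.j k (P.u k s) := by
    rw [P.j_eq]
    exact congrArg _ h
  rw [h2, P.u_eq, map_smul, smul_smul, mul_one_div_cancel hlam, one_smul]

theorem BPSystem.j_mem_G (P : BPSystem lam ε F) (hlam : lam ≠ 0) (k : ℕ) {x : P.E k}
    (hx : x ∈ P.G k) : P.j k x ∈ P.G (k + 1) := by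
  obtain ⟨s, hs⟩ := (P.T k).surjective ⟨x, P.mem_H_of_mem_G k hx⟩
  have := P.j_eq_smul hlam k s
  rw [hs] at this
  change P.j k x = _ at this
  rw [this]
  refine Submodule.smul_mem _ _ ?_
  rw [← SetLike.mem_coe, P.G_succ]
  exact ⟨_, rfl⟩

theorem BPSystem.monotone_map_G (P : BPSystem lam ε F) (hlam : lam ≠ 0) :
    Monotone fun n => (P.G n).map (toIndLimitₗᵢ P.j n).toLinearMap := by
  refine monotone_nat_of_le_succ fun n => ?_
  rintro _ ⟨x, hx, rfl⟩
  exact ⟨P.j n x, P.j_mem_G hlam n hx, toIndLimit_succ P.j n x⟩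

/-- `⋃_n J_n(G_n)` is a linear subspace. -/
theorem BPSystem.coe_iSup_map_G (P : BPSystem lam ε F) (hlam : lam ≠ 0) :
    ((⨆ n, (P.G n).map (toIndLimitₗᵢ P.j n).toLinearMap : Submodule ℝ (IndLimit P.j)) :
      Set (IndLimit P.j)) = ⋃ n, toIndLimit P.j n '' (P.G n : Set (P.E n)) :=
  Submodule.coe_iSup_of_directed _ (P.monotone_map_G hlam).directed_le

end Limit

/-- The limit is separable, so it embeds in C(2^ℕ); by completeness the isometric image of a closed
subspace is closed. -/
theorem exists_isBPSpace {lam ε : ℝ} (hlam : 1 < lam) (hε : 0 < ε) (hle : 1 + ε ≤ lam)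
    {X : Type} [NormedAddCommGroup X] [NormedSpace ℝ X] [TopologicalSpace.SeparableSpace X]
    (F : ℕ → Submodule ℝ X) (hF : ∀ n, FiniteDimensional ℝ (F n)) :
    ∃ Y : SB, IsBPSpace lam ε F Y.toSubmodule := by
  obtain ⟨P⟩ := exists_bpSystem hlam hε hle F hF
  have := separableSpace_indLimit P.j P.separableSpace
  obtain ⟨Θ⟩ := exists_linearIsometry_cantorFun (IndLimit P.j)
  let Z : Submodule ℝ (IndLimit P.j) :=
    (⨆ n, (P.G n).map (toIndLimitₗᵢ P.j n).toLinearMap).topologicalClosure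
  have hZ : IsClosed (Z : Set (IndLimit P.j)) := Submodule.isClosed_topologicalClosure _
  have hY : IsClosed ((Z.map Θ.toLinearMap : Submodule ℝ CantorFun) : Set CantorFun) :=
    Θ.isometry.isClosedEmbedding.isClosedMap _ hZ
  let f : Z ≃ₗᵢ[ℝ] (Z.map Θ.toLinearMap : Submodule ℝ CantorFun) :=
    ⟨Submodule.equivMapOfInjective Θ.toLinearMap Θ.injective Z, fun z => Θ.norm_map z⟩
  refine ⟨⟨Z.map Θ.toLinearMap, hY⟩, P, Z.subtypeₗᵢ.comp f.symm.toLinearIsometry, ?_⟩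
  rw [← P.coe_iSup_map_G (by linarith), ← Submodule.topologicalClosure_coe]
  ext z
  constructor
  · rintro ⟨y, rfl⟩
    exact (f.symm y).2
  · intro hz
    exact ⟨f ⟨z, hz⟩, by simp⟩

/-! ### Coding the construction by sequences of vectors -/

/-- The index set of the generators of `H_k`. -/
abbrev HIndex : Type := (ℕ × ℕ) ⊕ ℕ

section Code

variable {V : Type} [NormedAddCommGroup V] [NormedSpace ℝ V]

/-- Generators of `G_k`, where `g (k, i)` is the image of the `i`-th unit vector under `ũ_k`. -/
def gPrev (g : ℕ × ℕ → V) : ℕ → ℕ → V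
  | 0, _ => 0
  | k + 1, i => g (k, i)

/-- Generators of `H_k`, where `F_k` is spanned by the `x (l, i)` with `l ≤ k`. -/
def hGen (x g : ℕ × ℕ → V) (k : ℕ) : HIndex → V
  | Sum.inl p => if p.1 ≤ k then x p else 0
  | Sum.inr i => gPrev g k i

/-- Topological generators of `E_k`. -/
def eGen (x g : ℕ × ℕ → V) (k : ℕ) : (ℕ × ℕ) ⊕ (ℕ × ℕ) → V
  | Sum.inl p => x p
  | Sum.inr p => if p.1 < k then g p else 0

/-- The operator `ũ_k : ℓ_∞^n → E_{k+1}`. -/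
def gMap (n : ℕ) (g : ℕ × ℕ → V) (k : ℕ) : (Fin n → ℝ) →ₗ[ℝ] V :=
  Fintype.linearCombination ℝ fun i : Fin n => g (k, i)

/-- The first `n` entries of a sequence. -/
def trunc (n : ℕ) (f : ℕ → ℝ) : Fin n → ℝ := fun i => f i

/-- The spaces `E_k`. -/
def eSpace (m : ℕ → ℕ) (x g : ℕ × ℕ → V) : ℕ → Submodule ℝ V
  | 0 => closedSpan x
  | k + 1 => eSpace m x g k ⊔ LinearMap.range (gMap (m k) g k)

/-- The vectors `x`, `g` and `s` code the `k`-th step of the construction, with `m_k = n`. -/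
structure IsStepCode (lam ε : ℝ) (k n : ℕ) (x g : ℕ × ℕ → V) (s : HIndex → ℕ → ℝ) : Prop where
  le : k + 1 ≤ n
  -- Minimality of m_k, stated through generators by `almostEmbeds_iff`.
  least : ∀ d, k + 1 ≤ d → d < n → ¬ ∃ v : HIndex → Fin d → ℝ, Fits ε (hGen x g k) v
  fits : Fits ε (hGen x g k) fun r => trunc n (s r)
  -- The identity h = λ ũ_k(T_k⁻¹ h): on S_k the operator ũ_k coincides with u_k, the j_k being
  -- inclusions.
  smul_gMap : ∀ r, lam • gMap n g k (trunc n (s r)) = hGen x g k r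
  norm_gMap_le : ∀ b, ‖gMap n g k b‖ ≤ ‖b‖
  -- The nontrivial half of the norm formula of the canonical triple, imposed only on rational data
  -- so that the condition is a countable intersection.
  exists_lt : ∀ (b : Fin n → ℚ) (c : (ℕ × ℕ) ⊕ (ℕ × ℕ) →₀ ℚ) (p : ℕ), ∃ a : HIndex →₀ ℝ,
    ‖(fun i => (b i : ℝ)) + comb (fun r => trunc n (s r)) a‖ +
      ‖ratComb (eGen x g k) c - (1 / lam) • comb (hGen x g k) a‖ <
    ‖gMap n g k (fun i => (b i : ℝ)) + ratComb (eGen x g k) c‖ + 1 / ((p : ℝ) + 1)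
  -- Zero padding, so that infinite sequences can code finitely many vectors.
  eq_zero : ∀ i, n ≤ i → g (k, i) = 0

theorem gMap_apply (n : ℕ) (g : ℕ × ℕ → V) (k : ℕ) (b : Fin n → ℝ) :
    gMap n g k b = ∑ i, b i • g (k, i) := rfl

theorem gMap_single (n : ℕ) (g : ℕ × ℕ → V) (k : ℕ) (i : Fin n) :
    gMap n g k (Pi.single i 1) = g (k, i) := by
  simp [gMap]

theorem range_gMap {n : ℕ} {g : ℕ × ℕ → V} {k : ℕ} (h : ∀ i, n ≤ i → g (k, i) = 0) :
    LinearMap.range (gMap n g k) = Submodule.span ℝ (Set.range fun i : ℕ => g (k, i)) := by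
  rw [gMap, Fintype.range_linearCombination]
  refine le_antisymm (Submodule.span_mono ?_) (Submodule.span_le.2 ?_)
  · rintro _ ⟨i, rfl⟩
    exact ⟨i, rfl⟩
  · rintro _ ⟨i, rfl⟩
    by_cases hi : i < n
    · exact Submodule.subset_span ⟨⟨i, hi⟩, rfl⟩
    · change g (k, i) ∈ _
      rw [h i (not_lt.1 hi)]
      exact Submodule.zero_mem _

variable {lam ε : ℝ} {m : ℕ → ℕ} {x g : ℕ × ℕ → V} {s : ℕ → HIndex → ℕ → ℝ}

theorem eSpace_mono : Monotone (eSpace m x g) :=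
  monotone_nat_of_le_succ fun _ => le_sup_left

theorem x_mem_eSpace (k : ℕ) (p : ℕ × ℕ) : x p ∈ eSpace m x g k :=
  eSpace_mono (Nat.zero_le k) (mem_closedSpan x p)

theorem g_mem_eSpace (h0 : ∀ k i, m k ≤ i → g (k, i) = 0) {l k : ℕ} (hl : l < k) (i : ℕ) :
    g (l, i) ∈ eSpace m x g k := by
  refine eSpace_mono (Nat.succ_le_of_lt hl) (Submodule.mem_sup_right ?_)
  rw [range_gMap (h0 l)]
  exact Submodule.subset_span ⟨i, rfl⟩

theorem gPrev_mem_eSpace (h0 : ∀ k i, m k ≤ i → g (k, i) = 0) (k i : ℕ) :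
    gPrev g k i ∈ eSpace m x g k := by
  cases k with
  | zero => exact Submodule.zero_mem _
  | succ k => exact g_mem_eSpace h0 (Nat.lt_succ_self k) i

theorem hGen_mem_eSpace (h0 : ∀ k i, m k ≤ i → g (k, i) = 0) (k : ℕ) (r : HIndex) :
    hGen x g k r ∈ eSpace m x g k := by
  rcases r with p | i
  · simp only [hGen]
    split_ifs
    · exact x_mem_eSpace k p
    · exact Submodule.zero_mem _
  · exact gPrev_mem_eSpace h0 k i

/-- This puts E_k within reach of rational combinations of `eGen`, the only vectors on which a code
prescribes the norm formula. -/
theorem eSpace_le_closedSpan (h0 : ∀ k i, m k ≤ i → g (k, i) = 0) (k : ℕ) :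
    eSpace m x g k ≤ closedSpan (eGen x g k) := by
  have hx : ∀ k, closedSpan x ≤ closedSpan (eGen x g k) := fun k => by
    refine Submodule.topologicalClosure_mono (Submodule.span_mono ?_)
    rintro _ ⟨p, rfl⟩
    exact ⟨Sum.inl p, rfl⟩
  have hg : ∀ {l k : ℕ}, l < k →
      LinearMap.range (gMap (m l) g l) ≤ closedSpan (eGen x g k) := fun {l k} hl => by
    rw [range_gMap (h0 l)]
    refine (Submodule.span_mono ?_).trans (Submodule.le_topologicalClosure _)
    rintro _ ⟨i, rfl⟩
    exact ⟨Sum.inr (l, i), by simp [eGen, hl]⟩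
  have : ∀ l ≤ k, eSpace m x g l ≤ closedSpan (eGen x g k) := by
    intro l
    induction l with
    | zero => exact fun _ => hx k
    | succ l ih => exact fun hl => sup_le (ih (Nat.le_of_succ_le hl)) (hg hl)
  exact this k le_rfl

theorem comb_hGen {k n : ℕ} {s : HIndex → ℕ → ℝ} (hs : IsStepCode lam ε k n x g s)
    (a : HIndex →₀ ℝ) :
    comb (hGen x g k) a = lam • gMap n g k (comb (fun r => trunc n (s r)) a) := by
  rw [← LinearMap.smul_apply, map_comb]
  congr 2
  exact funext fun r => (hs.smul_gMap r).symm

/-- The norm formula of the canonical triple, extended from rational data by density. -/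
theorem IsStepCode.exists_lt_of_mem {k n : ℕ} {s : HIndex → ℕ → ℝ}
    (hs : IsStepCode lam ε k n x g s) (b : Fin n → ℝ) {e : V} (he : e ∈ closedSpan (eGen x g k))
    {δ : ℝ} (hδ : 0 < δ) :
    ∃ a : HIndex →₀ ℝ, ‖b + comb (fun r => trunc n (s r)) a‖ +
      ‖e - (1 / lam) • comb (hGen x g k) a‖ < ‖gMap n g k b + e‖ + δ := by
  -- Five errors are paid: ‖b - β‖ twice, ‖e - γ‖ twice, and 1/(p + 1) once.
  have hδ' : 0 < δ / 5 := by positivity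
  obtain ⟨b', hb'⟩ : ∃ b' : Fin n → ℚ, ‖b - fun i => (b' i : ℝ)‖ < δ / 5 := by
    choose b' hb' using fun i => exists_rat_near (b i) hδ'
    refine ⟨b', (pi_norm_lt_iff hδ').2 fun i => ?_⟩
    rw [Real.norm_eq_abs]
    exact hb' i
  obtain ⟨_, ⟨c, rfl⟩, hc⟩ := Metric.mem_closure_iff.1
    (topologicalClosure_span_le_closure_ratComb _ he) (δ / 5) hδ'
  rw [dist_eq_norm] at hc
  obtain ⟨p, hp⟩ := exists_nat_one_div_lt hδ'
  obtain ⟨a, ha⟩ := hs.exists_lt b' c p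
  refine ⟨a, ?_⟩
  set β : Fin n → ℝ := fun i => (b' i : ℝ)
  set γ := ratComb (eGen x g k) c
  set σ := comb (fun r => trunc n (s r)) a
  set τ := (1 / lam) • comb (hGen x g k) a
  have h1 : ‖b + σ‖ ≤ ‖β + σ‖ + ‖b - β‖ := by
    have : b + σ = (β + σ) + (b - β) := by abel
    rw [this]
    exact norm_add_le _ _
  have h2 : ‖e - τ‖ ≤ ‖γ - τ‖ + ‖e - γ‖ := by
    have : e - τ = (γ - τ) + (e - γ) := by abel
    rw [this]
    exact norm_add_le _ _
  have h3 : ‖gMap n g k β + γ‖ ≤ ‖gMap n g k b + e‖ + ‖b - β‖ + ‖e - γ‖ := by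
    have : gMap n g k β + γ = (gMap n g k b + e) - gMap n g k (b - β) - (e - γ) := by
      rw [map_sub]
      abel
    rw [this]
    refine (norm_sub_le _ _).trans (add_le_add ((norm_sub_le _ _).trans ?_) le_rfl)
    exact add_le_add le_rfl (hs.norm_gMap_le _)
  linarith

/-- The generators of G_k are among those of H_k, and `smul_gMap` puts the latter in the range of
ũ_k, which is G_{k+1}. -/
theorem span_gPrev_mono (hs : ∀ k, IsStepCode lam ε k (m k) x g (s k)) :
    Monotone fun k => Submodule.span ℝ (Set.range (gPrev g k)) := by
  refine monotone_nat_of_le_succ fun k => Submodule.span_le.2 ?_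
  rintro _ ⟨i, rfl⟩
  have h1 : gPrev g k i = lam • gMap (m k) g k (trunc (m k) (s k (Sum.inr i))) :=
    ((hs k).smul_gMap (Sum.inr i)).symm
  have h2 : Submodule.span ℝ (Set.range (gPrev g (k + 1))) = LinearMap.range (gMap (m k) g k) :=
    (range_gMap (hs k).eq_zero).symm
  rw [h1, h2]
  exact ⟨lam • _, map_smul _ _ _⟩

/-- `⋃_k G_k` is the span of the vectors `g (k, i)`. -/
theorem iUnion_span_gPrev (hs : ∀ k, IsStepCode lam ε k (m k) x g (s k)) :
    ⋃ k, (Submodule.span ℝ (Set.range (gPrev g k)) : Set V) = Submodule.span ℝ (Set.range g) := by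
  rw [← Submodule.coe_iSup_of_directed _ (span_gPrev_mono hs).directed_le]
  congr 1
  refine le_antisymm (iSup_le fun k => Submodule.span_le.2 ?_) (Submodule.span_le.2 ?_)
  · rintro _ ⟨i, rfl⟩
    cases k with
    | zero => exact Submodule.zero_mem _
    | succ k => exact Submodule.subset_span ⟨(k, i), rfl⟩
  · rintro _ ⟨⟨k, i⟩, rfl⟩
    exact Submodule.mem_iSup_of_mem (k + 1) (Submodule.subset_span ⟨i, rfl⟩)

end Code

/-! ### From codes to the construction -/

section Decode

theorem exists_isometry_of_closedSpan_eq_top {ι X V : Type*} [NormedAddCommGroup X]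
    [NormedSpace ℝ X] [NormedAddCommGroup V] [NormedSpace ℝ V] [CompleteSpace X] [CompleteSpace V]
    (x : ι → X) (hx : closedSpan x = ⊤) (x' : ι → V) (h : ∀ c, ‖comb x' c‖ = ‖comb x c‖) :
    ∃ f : X ≃ₗᵢ[ℝ] closedSpan x', ∀ r, (f (x r) : V) = x' r := by
  obtain ⟨f, hf⟩ := exists_closedSpan_isometry x x' h
  exact ⟨((LinearIsometryEquiv.ofTop X _ hx).symm).trans f, hf⟩

variable {V : Type} [NormedAddCommGroup V] [NormedSpace ℝ V]
  {lam ε : ℝ} {m : ℕ → ℕ} {x g : ℕ × ℕ → V} {s : ℕ → HIndex → ℕ → ℝ}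

/-- The generators of `H_k` as elements of `E_k`. -/
def hGen' (h0 : ∀ k i, m k ≤ i → g (k, i) = 0) (k : ℕ) (r : HIndex) : eSpace m x g k :=
  ⟨hGen x g k r, hGen_mem_eSpace h0 k r⟩

theorem coe_comb_hGen' (h0 : ∀ k i, m k ≤ i → g (k, i) = 0) (k : ℕ) (a : HIndex →₀ ℝ) :
    ((comb (hGen' (x := x) h0 k) a : eSpace m x g k) : V) = comb (hGen x g k) a := by
  rw [← Submodule.subtype_apply, map_comb]
  rfl

/-- The isomorphism `T_k`, the operator `u_k` and the isometry `Φ_k` obtained from a code. -/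
theorem IsStepCode.exists_maps (hlam : lam ≠ 0) (hs : ∀ k, IsStepCode lam ε k (m k) x g (s k))
    (k : ℕ) :
    ∃ (S : Submodule ℝ (Fin (m k) → ℝ))
      (T : S ≃ₗ[ℝ] Submodule.span ℝ
        (Set.range (hGen' (x := x) (fun k => (hs k).eq_zero) k)))
      (u : S →ₗ[ℝ] eSpace m x g k)
      (Φ : Kisliakov S u ≃ₗᵢ[ℝ] eSpace m x g (k + 1)),
      (∀ s : S, ‖s‖ ≤ ‖T s‖ ∧ ‖T s‖ ≤ (1 + ε) * ‖s‖) ∧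
      (∀ s : S, u s = (1 / lam) • (T s : eSpace m x g k)) ∧
      ∀ b e, (Φ (kisliakovMk S u b e) : V) = gMap (m k) g k b + e := by
  have h0 := fun k => (hs k).eq_zero
  have hfits : Fits ε (hGen' (x := x) h0 k) fun r => trunc (m k) (s k r) := by
    rw [← fits_comp ε (eSpace m x g k).subtypeₗᵢ]
    exact (hs k).fits
  obtain ⟨S, hS⟩ : ∃ S, S = Submodule.span ℝ (Set.range fun r => trunc (m k) (s k r)) := ⟨_, rfl⟩
  obtain ⟨T, hT, hTc⟩ := hfits.exists_equiv hS.symm rfl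
  let u : S →ₗ[ℝ] eSpace m x g k := (1 / lam) • (Submodule.subtype _ ∘ₗ T.toLinearMap)
  have hmem : ∀ a, comb (fun r => trunc (m k) (s k r)) a ∈ S := fun a => by
    rw [hS]
    exact comb_mem_span _ a
  have hu : ∀ a, u ⟨comb (fun r => trunc (m k) (s k r)) a, hmem a⟩ =
      (1 / lam) • comb (hGen' (x := x) h0 k) a := fun a => by
    rw [← hTc a (hmem a)]
    rfl
  -- The factor λ in `smul_gMap` cancels the 1/λ in the definition of u_k.
  have hgu : ∀ s : S, gMap (m k) g k s = (eSpace m x g k).subtypeₗᵢ (u s) := by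
    rintro ⟨v, hv⟩
    obtain ⟨a, rfl⟩ : v ∈ Set.range (comb fun r => trunc (m k) (s k r)) := by
      rw [range_comb, ← hS]
      exact hv
    rw [hu, map_smul, Submodule.coe_subtypeₗᵢ, Submodule.subtype_apply, coe_comb_hGen',
      comb_hGen (hs k), smul_smul, one_div_mul_cancel hlam, one_smul]
  have hinf : ∀ (b : Fin (m k) → ℝ) (e : eSpace m x g k), ∀ δ > 0, ∃ s : S,
      ‖b + s‖ + ‖e - u s‖ < ‖gMap (m k) g k b + (eSpace m x g k).subtypeₗᵢ e‖ + δ := by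
    intro b e δ hδ
    obtain ⟨a, ha⟩ := (hs k).exists_lt_of_mem b (eSpace_le_closedSpan h0 k e.2) hδ
    refine ⟨⟨_, hmem a⟩, ?_⟩
    rw [hu, Submodule.coe_norm, Submodule.coe_sub, Submodule.coe_smul, coe_comb_hGen']
    exact ha
  obtain ⟨Φ, hΦ⟩ := exists_kisliakov_equiv S u (eSpace m x g k).subtypeₗᵢ (gMap (m k) g k)
    (hs k).norm_gMap_le hgu hinf (eSpace m x g (k + 1)) (by
      change eSpace m x g k ⊔ _ = LinearMap.range (eSpace m x g k).subtype ⊔ _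
      rw [Submodule.range_subtype])
  exact ⟨S, T, u, Φ, hT, fun _ => rfl, hΦ⟩

/-- Codes give Bourgain–Pisier spaces. -/
theorem isBPSpace_of_isStepCode [CompleteSpace V] {X Y : Type} [NormedAddCommGroup X]
    [NormedSpace ℝ X] [CompleteSpace X] [NormedAddCommGroup Y] [NormedSpace ℝ Y] [CompleteSpace Y]
    (hlam : lam ≠ 0) (hs : ∀ k, IsStepCode lam ε k (m k) x g (s k))
    {x₀ : ℕ × ℕ → X} (hx₀ : closedSpan x₀ = ⊤) (hx : ∀ c, ‖comb x c‖ = ‖comb x₀ c‖)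
    {y : ℕ × ℕ → Y} (hy : closedSpan y = ⊤) (hg : ∀ c, ‖comb g c‖ = ‖comb y c‖)
    {F : ℕ → Submodule ℝ X} (hF : ∀ k, F k = Submodule.span ℝ (x₀ '' {p | p.1 ≤ k})) :
    IsBPSpace lam ε F Y := by
  have h0 := fun k => (hs k).eq_zero
  choose S T u Φ hT hu hΦ using IsStepCode.exists_maps hlam hs
  obtain ⟨e, he⟩ := exists_isometry_of_closedSpan_eq_top x₀ hx₀ x hx
  obtain ⟨f, hf⟩ := exists_isometry_of_closedSpan_eq_top y hy g hg
  -- All stages lie in V, so the connecting maps are inclusions.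
  let j : ∀ n, eSpace m x g n →ₗᵢ[ℝ] eSpace m x g (n + 1) := fun n =>
    ⟨Submodule.inclusion (eSpace_mono (Nat.le_succ n)), fun _ => rfl⟩
  let g' : ∀ k, ℕ → eSpace m x g k := fun k i => ⟨gPrev g k i, gPrev_mem_eSpace h0 k i⟩
  let G : ∀ k, Submodule ℝ (eSpace m x g k) := fun k => Submodule.span ℝ (Set.range (g' k))
  have hG : ∀ k, (Subtype.val '' (G k : Set (eSpace m x g k)) : Set V) =
      Submodule.span ℝ (Set.range (gPrev g k)) := by
    intro k
    have : (G k).map (eSpace m x g k).subtype = Submodule.span ℝ (Set.range (gPrev g k)) := by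
      rw [Submodule.map_span, ← Set.range_comp]
      rfl
    rw [← this]
    rfl
  let e' : X ≃ₗᵢ[ℝ] eSpace m x g 0 := e
  have hiter : ∀ k p, (iterEmb (E := fun n => eSpace m x g n) j e' k (x₀ p) : V) = x p := by
    intro k p
    induction k with
    | zero => exact he p
    | succ k ih => exact ih
  have hH : ∀ k, Submodule.span ℝ (Set.range (hGen' (x := x) h0 k)) = Submodule.span ℝ
      ((iterEmb (E := fun n => eSpace m x g n) j e' k '' (F k : Set X)) ∪
        (G k : Set (eSpace m x g k))) := by
    intro k
    rw [Submodule.span_union, Submodule.span_eq, hF,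
      ← (iterEmb (E := fun n => eSpace m x g n) j e' k).coe_toLinearMap, Submodule.span_image,
      Submodule.span_eq, ← Submodule.span_image]
    refine le_antisymm (Submodule.span_le.2 ?_) (sup_le (Submodule.span_le.2 ?_)
      (Submodule.span_le.2 ?_))
    · rintro _ ⟨p | i, rfl⟩
      · by_cases hp : p.1 ≤ k
        · refine Submodule.mem_sup_left (Submodule.subset_span ⟨x₀ p, ⟨p, hp, rfl⟩, ?_⟩)
          exact Subtype.ext ((hiter k p).trans (by simp [hGen', hGen, hp]))
        · have : hGen' (x := x) h0 k (Sum.inl p) = 0 := Subtype.ext (by simp [hGen', hGen, hp])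
          rw [this]
          exact Submodule.zero_mem _
      · exact Submodule.mem_sup_right (Submodule.subset_span ⟨i, rfl⟩)
    · rintro _ ⟨_, ⟨p, hp, rfl⟩, rfl⟩
      refine Submodule.subset_span ⟨Sum.inl p, Subtype.ext ?_⟩
      have hp' : p.1 ≤ k := hp
      exact (by simp [hGen', hGen, hp'] : (hGen' (x := x) h0 k (Sum.inl p) : V) = x p).trans
        (hiter k p).symm
    · rintro _ ⟨i, rfl⟩
      exact Submodule.subset_span ⟨Sum.inr i, rfl⟩
  let P : BPSystem lam ε F :=
    { E := fun n => eSpace m x g n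
      j := j
      G := G
      e := e'
      G_zero := by
        rw [eq_bot_iff, Submodule.span_le]
        rintro _ ⟨i, rfl⟩
        exact Subtype.ext rfl
      H := fun k => Submodule.span ℝ (Set.range (hGen' (x := x) h0 k))
      H_eq := hH
      m := m
      m_least := fun k => by
        have hA : ∀ d, AlmostEmbeds ε d (Submodule.span ℝ (Set.range (hGen' (x := x) h0 k))) ↔
            ∃ v : HIndex → Fin d → ℝ, Fits ε (hGen x g k) v := fun d => by
          rw [almostEmbeds_iff rfl]
          exact exists_congr fun v => (fits_comp ε (eSpace m x g k).subtypeₗᵢ _ v).symm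
        refine ⟨⟨(hs k).le, (hA _).2 ⟨_, (hs k).fits⟩⟩, fun d hd => ?_⟩
        by_contra hlt
        exact (hs k).least d hd.1 (not_le.1 hlt) ((hA d).1 hd.2)
      S := S
      T := T
      T_bound := hT
      u := u
      u_eq := hu
      Φ := Φ
      j_eq := fun k e => Subtype.ext (by
        refine Eq.trans ?_ (hΦ k 0 e).symm
        rw [map_zero, zero_add]
        rfl)
      G_succ := fun k => by
        have h1 : ∀ b, (Φ k (kisliakovU (S k) (u k) b) : V) = gMap (m k) g k b := fun b =>
          (hΦ k b 0).trans (by simp)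
        refine Set.image_injective.2 Subtype.val_injective ?_
        rw [hG (k + 1), ← Set.range_comp]
        have h2 : Submodule.span ℝ (Set.range (gPrev g (k + 1))) =
          LinearMap.range (gMap (m k) g k) := (range_gMap (h0 k)).symm
        rw [h2]
        exact congrArg Set.range (funext fun b => (h1 b).symm) }
  -- The abstract limit is carried into V, and the closure of ⋃ J_n(G_n) onto the closed span of
  -- `g`. That span is isometric to Y through `f`, and pulling `f` back along Ψ embeds Y in the
  -- limit.
  obtain ⟨Ψ, hΨ⟩ := exists_linearIsometry_indLimit P.j (V := V)
    (fun n => (eSpace m x g n).subtypeₗᵢ) (fun _ _ => rfl)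
  have hcl : closure (Ψ '' ⋃ n, toIndLimit P.j n '' (P.G n : Set (P.E n))) = closedSpan g := by
    rw [Submodule.topologicalClosure_coe, ← iUnion_span_gPrev hs, Set.image_iUnion]
    congr 1
    refine Set.iUnion_congr fun n => ?_
    rw [← hG n, Set.image_image]
    exact Set.image_congr fun v _ => hΨ n v
  have hcl2 : Ψ '' closure (⋃ n, toIndLimit P.j n '' (P.G n : Set (P.E n))) = closedSpan g := by
    rw [← hcl]
    exact (Ψ.isometry.isClosedEmbedding.closure_image_eq _).symm
  have hrange : ∀ v : closedSpan g, (v : V) ∈ LinearMap.range Ψ.toLinearMap := by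
    intro v
    obtain ⟨z, -, hz⟩ : (v : V) ∈ Ψ '' _ := by
      rw [hcl2]
      exact v.2
    exact ⟨z, hz⟩
  let φ₀ : Y →ₗᵢ[ℝ] LinearMap.range Ψ.toLinearMap :=
    ⟨((closedSpan g).subtype ∘ₗ f.toLinearEquiv.toLinearMap).codRestrict _ fun y => hrange (f y),
      fun y => f.norm_map y⟩
  let φ : Y →ₗᵢ[ℝ] IndLimit P.j := Ψ.equivRange.symm.toLinearIsometry.comp φ₀
  have hφ : ∀ y, Ψ (φ y) = f y := fun y =>
    congrArg Subtype.val (Ψ.equivRange.apply_symm_apply (φ₀ y))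
  refine ⟨P, φ, Set.image_injective.2 Ψ.injective ?_⟩
  rw [hcl2, ← Set.range_comp]
  ext v
  constructor
  · rintro ⟨y, rfl⟩
    change Ψ (φ y) ∈ _
    rw [hφ]
    exact (f y).2
  · intro hv
    refine ⟨f.symm ⟨v, hv⟩, ?_⟩
    change Ψ (φ _) = v
    rw [hφ, LinearIsometryEquiv.apply_symm_apply]

end Decode

/-! ### From the construction to codes -/

section Encode

variable {X : Type} [NormedAddCommGroup X] [NormedSpace ℝ X] {lam ε : ℝ} {F : ℕ → Submodule ℝ X}

/-- The image of the `i`-th unit vector under `ũ_k`. -/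
def BPSystem.unit (P : BPSystem lam ε F) (k i : ℕ) : P.E (k + 1) :=
  if h : i < P.m k then P.Φ k (kisliakovU (P.S k) (P.u k) (Pi.single ⟨i, h⟩ 1)) else 0

/-- Units of different stages lie in different spaces, so the family is taken constant in its first
index; `gMap` reads it only at stage k. -/
theorem BPSystem.gMap_unit (P : BPSystem lam ε F) (k : ℕ) (b : Fin (P.m k) → ℝ) :
    gMap (P.m k) (fun p : ℕ × ℕ => P.unit k p.2) k b = P.Φ k (kisliakovU (P.S k) (P.u k) b) := by
  have : gMap (P.m k) (fun p : ℕ × ℕ => P.unit k p.2) k =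
      (P.Φ k).toLinearEquiv.toLinearMap ∘ₗ kisliakovUₗ (P.S k) (P.u k) := by
    refine (Pi.basisFun ℝ (Fin (P.m k))).ext fun i => ?_
    rw [Pi.basisFun_apply, gMap_single]
    simp only [BPSystem.unit, i.2, dif_pos]
    rfl
  rw [this]
  rfl

/-- Generators of `G_k`. -/
def BPSystem.genG (P : BPSystem lam ε F) : ∀ k, ℕ → P.E k
  | 0, _ => 0
  | k + 1, i => P.unit k i

theorem BPSystem.span_genG (P : BPSystem lam ε F) (k : ℕ) :
    Submodule.span ℝ (Set.range (P.genG k)) = P.G k := by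
  cases k with
  | zero =>
    rw [P.G_zero, eq_bot_iff, Submodule.span_le]
    rintro _ ⟨i, rfl⟩
    exact rfl
  | succ k =>
    have h := range_gMap (n := P.m k) (g := fun p : ℕ × ℕ => P.unit k p.2) (k := k)
      (fun i hi => dif_neg (not_lt.2 hi))
    refine h.symm.trans (SetLike.coe_injective ?_)
    rw [P.G_succ]
    exact congrArg Set.range (funext (P.gMap_unit k))

/-- Generators of `H_k`, for `F_k` spanned by the `x (l, i)` with `l ≤ k`. -/
def BPSystem.genH (P : BPSystem lam ε F) (x : ℕ × ℕ → X) (k : ℕ) : HIndex → P.E k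
  | Sum.inl p => if p.1 ≤ k then iterEmb P.j P.e k (x p) else 0
  | Sum.inr i => P.genG k i

theorem BPSystem.span_genH (P : BPSystem lam ε F) {x : ℕ × ℕ → X}
    (hF : ∀ k, F k = Submodule.span ℝ (x '' {p | p.1 ≤ k})) (k : ℕ) :
    Submodule.span ℝ (Set.range (P.genH x k)) = P.H k := by
  rw [P.H_eq, Submodule.span_union, Submodule.span_eq, hF, ← (iterEmb P.j P.e k).coe_toLinearMap,
    Submodule.span_image, Submodule.span_eq, ← Submodule.span_image, ← P.span_genG]
  refine le_antisymm (Submodule.span_le.2 ?_) (sup_le (Submodule.span_le.2 ?_)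
    (Submodule.span_le.2 ?_))
  · rintro _ ⟨p | i, rfl⟩
    · by_cases hp : p.1 ≤ k
      · exact Submodule.mem_sup_left (Submodule.subset_span
          ⟨x p, ⟨p, hp, rfl⟩, by simp [BPSystem.genH, hp]⟩)
      · have : P.genH x k (Sum.inl p) = 0 := by simp [BPSystem.genH, hp]
        rw [this]
        exact Submodule.zero_mem _
    · exact Submodule.mem_sup_right (Submodule.subset_span ⟨i, rfl⟩)
  · rintro _ ⟨_, ⟨p, hp, rfl⟩, rfl⟩
    have hp' : p.1 ≤ k := hp
    exact Submodule.subset_span ⟨Sum.inl p, by simp [BPSystem.genH, hp']⟩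
  · rintro _ ⟨i, rfl⟩
    exact Submodule.subset_span ⟨Sum.inr i, rfl⟩

theorem BPSystem.genH_mem (P : BPSystem lam ε F) {x : ℕ × ℕ → X}
    (hF : ∀ k, F k = Submodule.span ℝ (x '' {p | p.1 ≤ k})) (k : ℕ) (r : HIndex) :
    P.genH x k r ∈ P.H k :=
  P.span_genH hF k ▸ Submodule.subset_span ⟨r, rfl⟩

/-- The preimages under `T_k` of the generators of `H_k`. -/
def BPSystem.sVec (P : BPSystem lam ε F) {x : ℕ × ℕ → X}
    (hF : ∀ k, F k = Submodule.span ℝ (x '' {p | p.1 ≤ k})) (k : ℕ) (r : HIndex) (i : ℕ) : ℝ :=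
  if h : i < P.m k then
    ((P.T k).symm ⟨P.genH x k r, P.genH_mem hF k r⟩ : Fin (P.m k) → ℝ) ⟨i, h⟩ else 0

theorem BPSystem.trunc_sVec (P : BPSystem lam ε F) {x : ℕ × ℕ → X}
    (hF : ∀ k, F k = Submodule.span ℝ (x '' {p | p.1 ≤ k})) (k : ℕ) (r : HIndex) :
    trunc (P.m k) (P.sVec hF k r) = (P.T k).symm ⟨P.genH x k r, P.genH_mem hF k r⟩ := by
  ext i
  simp [trunc, BPSystem.sVec]

variable {V : Type} [NormedAddCommGroup V] [NormedSpace ℝ V]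

/-- A system realised inside `V` yields a code. -/
theorem BPSystem.isStepCode (P : BPSystem lam ε F) (hlam : lam ≠ 0) {x : ℕ × ℕ → X}
    (hF : ∀ k, F k = Submodule.span ℝ (x '' {p | p.1 ≤ k})) (J : ∀ n, P.E n →ₗᵢ[ℝ] V)
    (hJ : ∀ n v, J (n + 1) (P.j n v) = J n v) (k : ℕ) :
    IsStepCode lam ε k (P.m k) (fun p => J 0 (P.e (x p))) (fun p => J (p.1 + 1) (P.unit p.1 p.2))
      (P.sVec hF k) := by
  set g : ℕ × ℕ → V := fun p => J (p.1 + 1) (P.unit p.1 p.2)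
  set x' : ℕ × ℕ → V := fun p => J 0 (P.e (x p))
  have hg : ∀ b, gMap (P.m k) g k b = J (k + 1) (P.Φ k (kisliakovU (P.S k) (P.u k) b)) := by
    intro b
    rw [← P.gMap_unit, gMap_apply, gMap_apply, map_sum]
    exact Finset.sum_congr rfl fun i _ => ((J (k + 1)).map_smul _ _).symm
  have hiter : ∀ k v, J k (iterEmb P.j P.e k v) = J 0 (P.e v) := by
    intro k v
    induction k with
    | zero => rfl
    | succ k ih => exact (hJ k _).trans ih
  have hh : ∀ r, J k (P.genH x k r) = hGen x' g k r := by
    rintro (p | i)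
    · simp only [BPSystem.genH, hGen]
      split_ifs
      · exact hiter k _
      · exact map_zero _
    · cases k with
      | zero => exact map_zero _
      | succ k => rfl
  have hh' : (fun r => J k (P.genH x k r)) = hGen x' g k := funext hh
  have hA : ∀ d, AlmostEmbeds ε d (P.H k) ↔ ∃ v : HIndex → Fin d → ℝ, Fits ε (hGen x' g k) v := by
    intro d
    rw [almostEmbeds_iff (P.span_genH hF k), ← hh']
    exact exists_congr fun v => (fits_comp ε (J k) _ v).symm
  -- The images of the stages increase, so every combination of `eGen` at stage k is the image of a
  -- vector of E_k.
  have hrange : ∀ l k, l ≤ k → LinearMap.range (J l).toLinearMap ≤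
      LinearMap.range (J k).toLinearMap := by
    intro l k hlk
    induction k, hlk using Nat.le_induction with
    | base => exact le_rfl
    | succ k _ ih =>
      refine ih.trans ?_
      rintro _ ⟨v, rfl⟩
      exact ⟨P.j k v, hJ k v⟩
  have hs : (fun r => trunc (P.m k) (P.sVec hF k r)) =
      fun r => ((P.T k).symm ⟨P.genH x k r, P.genH_mem hF k r⟩ : Fin (P.m k) → ℝ) :=
    funext (P.trunc_sVec hF k)
  refine ⟨(P.m_least k).1.1, fun d hd hlt hv => ?_, ?_, fun r => ?_, fun b => ?_, ?_, ?_⟩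
  · exact not_le.2 hlt ((P.m_least k).2 ⟨hd, (hA d).2 hv⟩)
  · rw [hs, ← hh', fits_comp]
    exact fits_equiv_symm (P.T k) (P.T_bound k) (P.genH_mem hF k)
  · have := P.j_eq_smul hlam k ((P.T k).symm ⟨P.genH x k r, P.genH_mem hF k r⟩)
    rw [LinearEquiv.apply_symm_apply] at this
    rw [P.trunc_sVec, hg, ← hh, ← hJ k (P.genH x k r), ← map_smul]
    exact congrArg _ this.symm
  · rw [hg, LinearIsometry.norm_map, LinearIsometryEquiv.norm_map]
    exact norm_kisliakovU_le _ _ b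
  · intro b c p
    have hmem : ratComb (eGen x' g k) c ∈ LinearMap.range (J k).toLinearMap := by
      refine (Submodule.span_le.2 ?_) (comb_mem_span _ _)
      rintro _ ⟨q | q, rfl⟩
      · exact ⟨_, hiter k (x q)⟩
      · simp only [eGen]
        split_ifs with hq
        · exact hrange (q.1 + 1) k hq ⟨_, rfl⟩
        · exact Submodule.zero_mem _
    obtain ⟨v, hv⟩ := hmem
    have hv' : J k v = ratComb (eGen x' g k) c := hv
    set β : Fin (P.m k) → ℝ := fun i => (b i : ℝ)
    -- A near-minimiser t for the quotient norm. The coefficients a express T_k(t) in the generators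
    -- of H_k, and the same a express t in their preimages under T_k.
    obtain ⟨t, ht⟩ := exists_lt_norm_kisliakovMk (P.S k) (P.u k) β v
      (δ := 1 / ((p : ℝ) + 1)) (by positivity)
    obtain ⟨a, ha⟩ : (P.T k t : P.E k) ∈ Set.range (comb (P.genH x k)) := by
      rw [range_comb, P.span_genH hF]
      exact (P.T k t).2
    refine ⟨a, ?_⟩
    obtain ⟨hc, h1⟩ := comb_equiv_symm (P.T k) (P.genH_mem hF k) a
    have h2 : comb (fun r => trunc (P.m k) (P.sVec hF k r)) a = t := by
      rw [hs, h1]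
      have : (⟨comb (P.genH x k) a, hc⟩ : P.H k) = P.T k t := Subtype.ext ha
      rw [this, LinearEquiv.symm_apply_apply]
    have h3 : ratComb (eGen x' g k) c - (1 / lam) • comb (hGen x' g k) a =
        J k (v - P.u k t) := by
      rw [← hv', ← hh', ← (J k).coe_toLinearMap, ← map_comb, ha, P.u_eq, map_sub, map_smul]
    have h4 : gMap (P.m k) g k β + ratComb (eGen x' g k) c =
        J (k + 1) (P.Φ k (kisliakovMk (P.S k) (P.u k) β v)) := by
      have : kisliakovMk (P.S k) (P.u k) β v =
          kisliakovU (P.S k) (P.u k) β + kisliakovJ (P.S k) (P.u k) v := by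
        have := kisliakovMk_add (P.S k) (P.u k) β 0 0 v
        rwa [add_zero, zero_add] at this
      rw [hg, ← hv', ← hJ k v, P.j_eq, this, map_add, map_add]
    rw [h2, h3, h4, LinearIsometry.norm_map, LinearIsometry.norm_map, LinearIsometryEquiv.norm_map]
    exact ht
  · intro i hi
    have : P.unit k i = 0 := dif_neg (not_lt.2 hi)
    change J (k + 1) (P.unit k i) = 0
    rw [this, map_zero]

/-- Every Bourgain–Pisier space comes from a code in `C(2^ℕ)`. -/
theorem exists_isStepCode_of_isBPSpace [TopologicalSpace.SeparableSpace X] {Y : Type}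
    [NormedAddCommGroup Y] [NormedSpace ℝ Y] (hlam : lam ≠ 0) {x₀ : ℕ × ℕ → X}
    (hF : ∀ k, F k = Submodule.span ℝ (x₀ '' {p | p.1 ≤ k})) (h : IsBPSpace lam ε F Y) :
    ∃ (m : ℕ → ℕ) (x g : ℕ × ℕ → CantorFun) (s : ℕ → HIndex → ℕ → ℝ) (y : ℕ × ℕ → Y),
      (∀ k, IsStepCode lam ε k (m k) x g (s k)) ∧ (∀ c, ‖comb x c‖ = ‖comb x₀ c‖) ∧
      closedSpan y = ⊤ ∧ ∀ c, ‖comb g c‖ = ‖comb y c‖ := by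
  obtain ⟨P, φ, hφ⟩ := h
  have := separableSpace_indLimit P.j P.separableSpace
  obtain ⟨Θ⟩ := exists_linearIsometry_cantorFun (IndLimit P.j)
  let J : ∀ n, P.E n →ₗᵢ[ℝ] CantorFun := fun n => Θ.comp (toIndLimitₗᵢ P.j n)
  have hJ : ∀ n v, J (n + 1) (P.j n v) = J n v := fun n v => congrArg Θ (toIndLimit_succ P.j n v)
  have hcode := P.isStepCode hlam hF J hJ
  set g : ℕ × ℕ → CantorFun := fun p => J (p.1 + 1) (P.unit p.1 p.2)
  have hG : ∀ k, J k '' (P.G k : Set (P.E k)) = Submodule.span ℝ (Set.range (gPrev g k)) := by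
    intro k
    rw [← P.span_genG, ← (J k).coe_toLinearMap, ← Submodule.map_coe, Submodule.map_span,
      ← Set.range_comp]
    congr 3
    funext i
    cases k with
    | zero => exact map_zero _
    | succ k => rfl
  have hrange : Set.range (Θ.comp φ) = closedSpan g := by
    rw [LinearIsometry.coe_comp, Set.range_comp, hφ, ← Θ.isometry.isClosedEmbedding.closure_image_eq,
      Submodule.topologicalClosure_coe, ← iUnion_span_gPrev hcode, Set.image_iUnion]
    congr 1
    refine Set.iUnion_congr fun n => ?_
    rw [← hG n, Set.image_image]
    rfl
  -- Pulling `g` back along the isometry of Y onto its closed span gives generators of Y with the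
  -- same norms of combinations.
  have hy : ∀ p, ∃ y, Θ.comp φ y = g p := fun p => by
    change g p ∈ Set.range (Θ.comp φ)
    rw [hrange]
    exact mem_closedSpan g p
  choose y hy using hy
  refine ⟨P.m, _, g, P.sVec hF, y, hcode, fun c => ?_,
    closedSpan_eq_top_of_range g y (Θ.comp φ) hrange.subset hy, fun c => ?_⟩
  · have := map_comb ((J 0).toLinearMap ∘ₗ P.e.toLinearEquiv.toLinearMap) x₀ c
    refine (congrArg norm this.symm).trans ?_
    exact ((J 0).norm_map _).trans (P.e.norm_map _)
  · have := map_comb (Θ.comp φ).toLinearMap y c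
    have hgy : (fun r => (Θ.comp φ).toLinearMap (y r)) = g := funext hy
    rw [hgy] at this
    rw [← this]
    exact (Θ.comp φ).norm_map _

end Encode

/-! ### The set of codes is Borel -/

section Measurability

theorem continuous_hGen {V : Type} [NormedAddCommGroup V] (k : ℕ) :
    Continuous fun p : (ℕ × ℕ → V) × (ℕ × ℕ → V) => hGen p.1 p.2 k := by
  refine continuous_pi ?_
  rintro (q | i)
  · simp only [hGen]
    split_ifs
    · exact (continuous_apply q).comp continuous_fst
    · exact continuous_const
  · cases k with
    | zero => exact continuous_const
    | succ k => exact (continuous_apply (k, i)).comp continuous_snd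

theorem continuous_eGen {V : Type} [NormedAddCommGroup V] (k : ℕ) :
    Continuous fun p : (ℕ × ℕ → V) × (ℕ × ℕ → V) => eGen p.1 p.2 k := by
  refine continuous_pi ?_
  rintro (q | q)
  · exact (continuous_apply q).comp continuous_fst
  · simp only [eGen]
    split_ifs
    · exact (continuous_apply q).comp continuous_snd
    · exact continuous_const

variable {V : Type} [NormedAddCommGroup V] [NormedSpace ℝ V]

theorem continuous_gMap (n k : ℕ) (b : Fin n → ℝ) :
    Continuous fun g : ℕ × ℕ → V => gMap n g k b := by
  simp only [gMap_apply]
  fun_prop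

theorem continuous_gMap_trunc (n k : ℕ) :
    Continuous fun p : (ℕ × ℕ → V) × (ℕ → ℝ) => gMap n p.1 k (trunc n p.2) := by
  simp only [gMap_apply, trunc]
  refine continuous_finsetSum _ fun i _ => ?_
  exact ((continuous_apply (i : ℕ)).comp continuous_snd).smul
    ((continuous_apply (k, (i : ℕ))).comp continuous_fst)

theorem continuous_trunc (n : ℕ) : Continuous (trunc n) :=
  continuous_pi fun i => continuous_apply (i : ℕ)

theorem isClosed_setOf_fits (ε : ℝ) {ι Z W : Type*} [TopologicalSpace Z] [NormedAddCommGroup W]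
    [NormedSpace ℝ W] {h : Z → ι → V} {v : Z → ι → W} (hh : Continuous h) (hv : Continuous v) :
    IsClosed {z | Fits ε (h z) (v z)} := by
  simp only [Fits, Set.ofPred_forall, Set.ofPred_and]
  have h1 : ∀ c, Continuous fun z => comb (v z) c := fun c => (continuous_comb c).comp hv
  have h2 : ∀ c, Continuous fun z => comb (h z) c := fun c => (continuous_comb c).comp hh
  exact isClosed_iInter fun c => (isClosed_le (h1 c).norm (h2 c).norm).inter
    (isClosed_le (h2 c).norm (continuous_const.mul (h1 c).norm))

/-- Every clause is a countable combination of closed and open conditions. The existential inside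
minimality is closed by `isClosed_setOf_exists_fits`. -/
theorem measurableSet_isStepCode [MeasurableSpace V] [BorelSpace V] [SecondCountableTopology V]
    (lam ε : ℝ) (k n : ℕ) :
    MeasurableSet {p : ((ℕ × ℕ → V) × (ℕ × ℕ → V)) × (HIndex → ℕ → ℝ) |
      IsStepCode lam ε k n p.1.1 p.1.2 p.2} := by
  have hh : Continuous fun p : ((ℕ × ℕ → V) × (ℕ × ℕ → V)) × (HIndex → ℕ → ℝ) =>
      hGen p.1.1 p.1.2 k := (continuous_hGen k).comp continuous_fst
  have he : Continuous fun p : ((ℕ × ℕ → V) × (ℕ × ℕ → V)) × (HIndex → ℕ → ℝ) =>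
      eGen p.1.1 p.1.2 k := (continuous_eGen k).comp continuous_fst
  have hs : Continuous fun p : ((ℕ × ℕ → V) × (ℕ × ℕ → V)) × (HIndex → ℕ → ℝ) =>
      fun r => trunc n (p.2 r) :=
    continuous_pi fun r => (continuous_trunc n).comp ((continuous_apply r).comp continuous_snd)
  have hg : ∀ b, Continuous fun p : ((ℕ × ℕ → V) × (ℕ × ℕ → V)) × (HIndex → ℕ → ℝ) =>
      gMap n p.1.2 k b := fun b =>
    (continuous_gMap n k b).comp (continuous_snd.comp continuous_fst)
  have heq : {p : ((ℕ × ℕ → V) × (ℕ × ℕ → V)) × (HIndex → ℕ → ℝ) |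
      IsStepCode lam ε k n p.1.1 p.1.2 p.2} =
      {_p | k + 1 ≤ n} ∩
      (⋂ (d : ℕ) (_ : k + 1 ≤ d) (_ : d < n),
        {p | ∃ v : HIndex → Fin d → ℝ, Fits ε (hGen p.1.1 p.1.2 k) v}ᶜ) ∩
      {p | Fits ε (hGen p.1.1 p.1.2 k) fun r => trunc n (p.2 r)} ∩
      (⋂ r, {p | lam • gMap n p.1.2 k (trunc n (p.2 r)) = hGen p.1.1 p.1.2 k r}) ∩
      (⋂ b, {p | ‖gMap n p.1.2 k b‖ ≤ ‖b‖}) ∩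
      (⋂ (b : Fin n → ℚ) (c : (ℕ × ℕ) ⊕ (ℕ × ℕ) →₀ ℚ) (q : ℕ), ⋃ a : HIndex →₀ ℝ,
        {p | ‖(fun i => (b i : ℝ)) + comb (fun r => trunc n (p.2 r)) a‖ +
          ‖ratComb (eGen p.1.1 p.1.2 k) c - (1 / lam) • comb (hGen p.1.1 p.1.2 k) a‖ <
        ‖gMap n p.1.2 k (fun i => (b i : ℝ)) + ratComb (eGen p.1.1 p.1.2 k) c‖ +
          1 / ((q : ℝ) + 1)}) ∩
      (⋂ (i : ℕ) (_ : n ≤ i), {p | p.1.2 (k, i) = 0}) := by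
    ext p
    simp only [Set.mem_ofPred_eq, Set.mem_inter_iff, Set.mem_iInter, Set.mem_iUnion,
      Set.mem_compl_iff]
    exact ⟨fun h => ⟨⟨⟨⟨⟨⟨h.le, h.least⟩, h.fits⟩, h.smul_gMap⟩, h.norm_gMap_le⟩, h.exists_lt⟩,
      h.eq_zero⟩, fun ⟨⟨⟨⟨⟨⟨h1, h2⟩, h3⟩, h4⟩, h5⟩, h6⟩, h7⟩ => ⟨h1, h2, h3, h4, h5, h6, h7⟩⟩
  rw [heq]
  refine (((((((MeasurableSet.const _).inter ?_).inter ?_).inter ?_).inter ?_).inter ?_).inter ?_)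
  · refine MeasurableSet.iInter fun d => MeasurableSet.iInter fun _ => MeasurableSet.iInter fun _ =>
      MeasurableSet.compl ?_
    exact ((isClosed_setOf_exists_fits ε d).preimage hh).measurableSet
  · exact (isClosed_setOf_fits ε hh hs).measurableSet
  · refine (isClosed_iInter fun r => isClosed_eq ?_ ((continuous_apply r).comp hh)).measurableSet
    exact ((continuous_gMap_trunc n k).comp ((continuous_snd.comp continuous_fst).prodMk
      ((continuous_apply r).comp continuous_snd))).const_smul lam
  · exact (isClosed_iInter fun b => isClosed_le (hg b).norm continuous_const).measurableSet
  -- The indices b, c, q range over countable sets. The coefficients a do not, but a union of open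
  -- sets is open.
  · refine MeasurableSet.iInter fun b => MeasurableSet.iInter fun c => MeasurableSet.iInter fun q =>
      (isOpen_iUnion fun a => isOpen_lt ?_ ?_).measurableSet
    · exact (continuous_const.add ((continuous_comb a).comp hs)).norm.add
        (((continuous_comb _).comp he).sub (((continuous_comb a).comp hh).const_smul _)).norm
    · exact ((hg _).add ((continuous_comb _).comp he)).norm.add continuous_const
  · refine (isClosed_biInter fun i _ => isClosed_eq ?_ continuous_const).measurableSet
    exact (continuous_apply (k, i)).comp (continuous_snd.comp continuous_fst)

end Measurability

/-! ### Borel parametrization of `SB` and the Polish space of codes -/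

/-- Closed spans of sequences in `C(2^ℕ)`, as points of `SB`. -/
def spanSB (x : ℕ × ℕ → CantorFun) : SB := (Submodule.span ℝ (Set.range x)).closure

/-- A closed span meets an open set U exactly when some finite linear combination of the generators
lies in U, and this is an open condition on the generators. -/
theorem measurable_spanSB : Measurable spanSB := by
  rw [measurable_comap_iff]
  refine measurable_generateFrom ?_
  rintro _ ⟨U, hU, rfl⟩
  have : (fun x => (spanSB x).toCloseds) ⁻¹'
      {F : TopologicalSpace.Closeds CantorFun | ((F : Set CantorFun) ∩ U).Nonempty} =
      ⋃ c, {x | comb x c ∈ U} := by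
    ext x
    simp only [Set.mem_preimage, Set.mem_ofPred_eq, Set.mem_iUnion]
    have h1 : ((spanSB x).toCloseds : Set CantorFun) = closure (Set.range (comb x)) := by
      rw [range_comb]
      rfl
    rw [h1, closure_inter_open_nonempty_iff hU]
    constructor
    · rintro ⟨_, ⟨c, rfl⟩, hc⟩
      exact ⟨c, hc⟩
    · rintro ⟨c, hc⟩
      exact ⟨_, ⟨c, rfl⟩, hc⟩
  change MeasurableSet ((fun x => (spanSB x).toCloseds) ⁻¹' _)
  rw [this]
  exact (isOpen_iUnion fun c => hU.preimage (continuous_comb c)).measurableSet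

/-- Borel images of Borel subsets of Polish spaces are analytic. -/
theorem isAnalytic_image {D α : Type*} [TopologicalSpace D] [PolishSpace D] [MeasurableSpace D]
    [BorelSpace D] [MeasurableSpace α] {B : Set D} (hB : MeasurableSet B) {f : D → α}
    (hf : Measurable f) : IsAnalytic (f '' B) := by
  have h := hB.analyticSet
  rw [MeasureTheory.AnalyticSet] at h
  rcases h with rfl | ⟨φ, hφ, rfl⟩
  · exact Or.inl (Set.image_empty f)
  · exact Or.inr ⟨f ∘ φ, hf.comp hφ.measurable, Set.range_comp f φ⟩

/-- The parameter space: sequences generating `X`, its copy inside the inductive limit, the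
numbers `m_k`, the images of unit vectors, generators of the `S_k` and a sequence generating `Y`. -/
abbrev CodeSpace : Type :=
  (ℕ × ℕ → CantorFun) × (ℕ × ℕ → CantorFun) × (ℕ → ℕ) × (ℕ × ℕ → CantorFun) ×
    (ℕ → HIndex → ℕ → ℝ) × (ℕ × ℕ → CantorFun)

/-- The codes of pairs `(X, Y)` with `Y` isometric to a Bourgain–Pisier space for `X`. -/
def codes (lam ε : ℝ) : Set CodeSpace :=
  {z | (∀ k, IsStepCode lam ε k (z.2.2.1 k) z.2.1 z.2.2.2.1 (z.2.2.2.2.1 k)) ∧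
    (∀ c, ‖comb z.2.1 c‖ = ‖comb z.1 c‖) ∧ ∀ c, ‖comb z.2.2.2.1 c‖ = ‖comb z.2.2.2.2.2 c‖}

instance : SecondCountableTopology CantorFun := inferInstance

instance : PolishSpace CantorFun := inferInstance

theorem polishSpace_prod (α β : Type*) [TopologicalSpace α] [TopologicalSpace β]
    [PolishSpace α] [PolishSpace β] : PolishSpace (α × β) := by
  let _ := TopologicalSpace.upgradeIsCompletelyMetrizable α
  let _ := TopologicalSpace.upgradeIsCompletelyMetrizable β
  infer_instance

instance : PolishSpace CodeSpace := by
  have h1 := polishSpace_prod (ℕ → HIndex → ℕ → ℝ) (ℕ × ℕ → CantorFun)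
  have h2 := polishSpace_prod (ℕ × ℕ → CantorFun)
    ((ℕ → HIndex → ℕ → ℝ) × (ℕ × ℕ → CantorFun))
  have h3 := polishSpace_prod (ℕ → ℕ)
    ((ℕ × ℕ → CantorFun) × (ℕ → HIndex → ℕ → ℝ) × (ℕ × ℕ → CantorFun))
  have h4 := polishSpace_prod (ℕ × ℕ → CantorFun)
    ((ℕ → ℕ) × (ℕ × ℕ → CantorFun) × (ℕ → HIndex → ℕ → ℝ) × (ℕ × ℕ → CantorFun))
  exact polishSpace_prod _ _

set_option synthInstance.maxSize 512 in
instance : BorelSpace CodeSpace := inferInstance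

theorem measurableSet_codes (lam ε : ℝ) : MeasurableSet (codes lam ε) := by
  have h1 : ∀ k, MeasurableSet {z : CodeSpace |
      IsStepCode lam ε k (z.2.2.1 k) z.2.1 z.2.2.2.1 (z.2.2.2.2.1 k)} := by
    intro k
    -- The dimension m_k is part of the code; splitting by its countably many values reduces to a
    -- fixed n.
    have : {z : CodeSpace | IsStepCode lam ε k (z.2.2.1 k) z.2.1 z.2.2.2.1 (z.2.2.2.2.1 k)} =
        ⋃ n, {z : CodeSpace | z.2.2.1 k = n} ∩
          {z : CodeSpace | IsStepCode lam ε k n z.2.1 z.2.2.2.1 (z.2.2.2.2.1 k)} := by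
      ext z
      simp
    rw [this]
    refine MeasurableSet.iUnion fun n => MeasurableSet.inter ?_ ?_
    · have hc : Continuous fun z : CodeSpace => z.2.2.1 k := by fun_prop
      exact hc.measurable (measurableSet_singleton n)
    · have hc : Continuous fun z : CodeSpace => ((z.2.1, z.2.2.2.1), z.2.2.2.2.1 k) := by fun_prop
      exact hc.measurable (measurableSet_isStepCode lam ε k n)
  have h2 : ∀ (u v : CodeSpace → ℕ × ℕ → CantorFun), Continuous u → Continuous v →
      MeasurableSet {z | ∀ c, ‖comb (u z) c‖ = ‖comb (v z) c‖} := by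
    intro u v hu hv
    rw [Set.ofPred_forall]
    exact (isClosed_iInter fun c => isClosed_eq ((continuous_comb c).comp hu).norm
      ((continuous_comb c).comp hv).norm).measurableSet
  simp only [codes, Set.ofPred_and, Set.ofPred_forall (p := fun k (z : CodeSpace) =>
    IsStepCode lam ε k (z.2.2.1 k) z.2.1 z.2.2.2.1 (z.2.2.2.2.1 k))]
  exact (MeasurableSet.iInter h1).inter ((h2 _ _ (by fun_prop) (by fun_prop)).inter
    (h2 _ _ (by fun_prop) (by fun_prop)))

/-! ### Analyticity -/

/-- F_k embeds in H_k, which is isomorphic to a subspace of ℓ_∞^{m_k}. This recovers a condition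
that codes do not impose explicitly. -/
theorem IsBPSpace.finiteDimensional {X Y : Type} [NormedAddCommGroup X] [NormedSpace ℝ X]
    [NormedAddCommGroup Y] [NormedSpace ℝ Y] {lam ε : ℝ} {F : ℕ → Submodule ℝ X}
    (h : IsBPSpace lam ε F Y) (k : ℕ) : FiniteDimensional ℝ (F k) := by
  obtain ⟨P, -⟩ := h
  have : FiniteDimensional ℝ (P.H k) := (P.T k).finiteDimensional
  have hmem : ∀ v : F k, iterEmb P.j P.e k v ∈ P.H k := fun v => by
    rw [P.H_eq]
    exact Submodule.subset_span (Or.inl ⟨v, v.2, rfl⟩)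
  refine FiniteDimensional.of_injective
    (((iterEmb P.j P.e k).toLinearMap ∘ₗ (F k).subtype).codRestrict (P.H k) hmem) ?_
  intro v w hvw
  exact Subtype.ext ((iterEmb P.j P.e k).injective (congrArg Subtype.val hvw))

/-- A filtration is generated by a double sequence with dense span. -/
theorem IsFiltration.exists_generators {X : Type} [NormedAddCommGroup X] [NormedSpace ℝ X]
    {F : ℕ → Submodule ℝ X} (hF : IsFiltration F) :
    ∃ x : ℕ × ℕ → X, (∀ k, F k = Submodule.span ℝ (x '' {p | p.1 ≤ k})) ∧ closedSpan x = ⊤ := by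
  have h1 : ∀ k, ∃ z : ℕ → X, Submodule.span ℝ (Set.range z) = F k := by
    intro k
    have := hF.finite k
    obtain ⟨n, v, hv⟩ := Submodule.fg_iff_exists_fin_generating_family.1
      ((Submodule.fg_iff_finiteDimensional (F k)).2 this)
    refine ⟨fun i => if h : i < n then v ⟨i, h⟩ else 0, le_antisymm (Submodule.span_le.2 ?_) ?_⟩
    · rintro _ ⟨i, rfl⟩
      simp only
      split_ifs with h
      · rw [← hv]
        exact Submodule.subset_span ⟨⟨i, h⟩, rfl⟩
      · exact Submodule.zero_mem _
    · rw [← hv]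
      refine Submodule.span_mono ?_
      rintro _ ⟨i, rfl⟩
      exact ⟨i, by simp⟩
  choose z hz using h1
  have hmem : ∀ k i, z k i ∈ F k := fun k i => hz k ▸ Submodule.subset_span ⟨i, rfl⟩
  have hle : ∀ k, F k ≤ Submodule.span ℝ ((fun p : ℕ × ℕ => z p.1 p.2) '' {p | p.1 ≤ k}) := by
    intro k
    rw [← hz k]
    refine Submodule.span_mono ?_
    rintro _ ⟨i, rfl⟩
    exact ⟨(k, i), le_refl k, rfl⟩
  refine ⟨fun p => z p.1 p.2, fun k => le_antisymm (hle k) (Submodule.span_le.2 ?_), ?_⟩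
  · rintro _ ⟨p, hp, rfl⟩
    exact hF.mono hp (hmem _ _)
  · rw [eq_top_iff]
    intro v _
    refine closure_mono ?_ (hF.dense v)
    refine Set.iUnion_subset fun k => (hle k).trans (Submodule.span_mono ?_)
    exact Set.image_subset_range _ _

theorem isFiltration_of_generators {X : Type} [NormedAddCommGroup X] [NormedSpace ℝ X]
    {F : ℕ → Submodule ℝ X} (hfin : ∀ k, FiniteDimensional ℝ (F k)) {x : ℕ × ℕ → X}
    (hF : ∀ k, F k = Submodule.span ℝ (x '' {p | p.1 ≤ k})) (hx : closedSpan x = ⊤) :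
    IsFiltration F := by
  have hmono : Monotone F := fun k l hkl => by
    rw [hF, hF]
    exact Submodule.span_mono (Set.image_mono fun p (hp : p.1 ≤ k) => hp.trans hkl)
  refine ⟨hfin, hmono, ?_⟩
  have h2 : Submodule.span ℝ (Set.range x) ≤ ⨆ k, F k := by
    refine Submodule.span_le.2 ?_
    rintro _ ⟨p, rfl⟩
    refine Submodule.mem_iSup_of_mem p.1 ?_
    rw [hF]
    exact Submodule.subset_span ⟨p, le_refl p.1, rfl⟩
  rw [← Submodule.coe_iSup_of_directed _ hmono.directed_le]
  intro v
  have hv : v ∈ closedSpan x := hx ▸ Submodule.mem_top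
  exact closure_mono h2 hv

/-- The generators of `spanSB x` as elements of the space. -/
def spanSBGen (x : ℕ × ℕ → CantorFun) (p : ℕ × ℕ) : (spanSB x).toSubmodule :=
  ⟨x p, mem_closedSpan x p⟩

theorem closedSpan_spanSBGen (x : ℕ × ℕ → CantorFun) : closedSpan (spanSBGen x) = ⊤ :=
  closedSpan_eq_top_of_range x (spanSBGen x) (spanSB x).toSubmodule.subtypeₗᵢ
    (by rintro _ ⟨v, rfl⟩; exact v.2) fun _ => rfl

theorem norm_comb_coe {ι : Type*} (X : SB) (w : ι → X.toSubmodule) (c : ι →₀ ℝ) :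
    ‖comb (fun p => (w p : CantorFun)) c‖ = ‖comb w c‖ := by
  have := map_comb X.toSubmodule.subtypeₗᵢ.toLinearMap w c
  refine (congrArg norm this.symm).trans ?_
  exact X.toSubmodule.subtypeₗᵢ.norm_map _

/-- This makes decoding surjective: each X is the closed span of any generating family of its own.
-/
theorem spanSB_coe (X : SB) (w : ℕ × ℕ → X.toSubmodule) (hw : closedSpan w = ⊤) :
    spanSB (fun p => (w p : CantorFun)) = X := by
  refine SetLike.coe_injective (Set.Subset.antisymm ?_ fun v hv => ?_)
  · refine closure_minimal ?_ X.isClosed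
    refine (Submodule.span_le (p := X.toSubmodule)).2 ?_
    rintro _ ⟨p, rfl⟩
    exact (w p).2
  · have h1 : (⟨v, hv⟩ : X.toSubmodule) ∈ closedSpan w := hw ▸ Submodule.mem_top
    have h2 : (v : CantorFun) ∈ closure (X.toSubmodule.subtypeₗᵢ ''
        (Submodule.span ℝ (Set.range w) : Set X.toSubmodule)) :=
      image_closure_subset_closure_image X.toSubmodule.subtypeₗᵢ.continuous ⟨_, h1, rfl⟩
    refine closure_mono ?_ h2
    rintro _ ⟨u, hu, rfl⟩
    obtain ⟨c, rfl⟩ : u ∈ Set.range (comb w) := by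
      rw [range_comb]
      exact hu
    have := map_comb X.toSubmodule.subtypeₗᵢ.toLinearMap w c
    exact this ▸ comb_mem_span _ c

/-- The pair of spaces coded by a point of the parameter space. -/
def decode (z : CodeSpace) : SB × SB := (spanSB z.1, spanSB z.2.2.2.2.2)

theorem measurable_decode : Measurable decode :=
  (measurable_spanSB.comp measurable_fst).prodMk
    (measurable_spanSB.comp (by fun_prop))

theorem isBPSpace_of_mem_codes {lam ε : ℝ} (hlam : lam ≠ 0) {X Y : SB}
    {F : ℕ → Submodule ℝ X.toSubmodule} {x : ℕ × ℕ → X.toSubmodule}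
    (hF : ∀ k, F k = Submodule.span ℝ (x '' {p | p.1 ≤ k})) (hx : closedSpan x = ⊤)
    {y : ℕ × ℕ → Y.toSubmodule} (hy : closedSpan y = ⊤) {z : CodeSpace} (hz : z ∈ codes lam ε)
    (hzx : z.1 = fun p => (x p : CantorFun)) (hzy : z.2.2.2.2.2 = fun p => (y p : CantorFun)) :
    IsBPSpace (X := X.toSubmodule) lam ε F Y.toSubmodule := by
  have : CompleteSpace X.toSubmodule := X.isClosed.completeSpace_coe
  have : CompleteSpace Y.toSubmodule := Y.isClosed.completeSpace_coe
  obtain ⟨hs, hx', hy'⟩ := hz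
  rw [hzx] at hx'
  rw [hzy] at hy'
  exact isBPSpace_of_isStepCode (X := X.toSubmodule) (Y := Y.toSubmodule) hlam hs hx
    (fun c => (hx' c).trans (norm_comb_coe X x c)) hy
    (fun c => (hy' c).trans (norm_comb_coe Y y c)) hF

theorem exists_mem_codes_of_isBPSpace {lam ε : ℝ} (hlam : lam ≠ 0) {X Y : SB}
    {F : ℕ → Submodule ℝ X.toSubmodule} {x : ℕ × ℕ → X.toSubmodule}
    (hF : ∀ k, F k = Submodule.span ℝ (x '' {p | p.1 ≤ k})) (hx : closedSpan x = ⊤)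
    (h : IsBPSpace (X := X.toSubmodule) lam ε F Y.toSubmodule) :
    ∃ z ∈ codes lam ε, decode z = (X, Y) ∧ z.1 = fun p => (x p : CantorFun) := by
  obtain ⟨m, x', g, s, y, hs, hx', hy, hg⟩ :=
    exists_isStepCode_of_isBPSpace (X := X.toSubmodule) (Y := Y.toSubmodule) hlam hF h
  refine ⟨(fun p => (x p : CantorFun), x', m, g, s, fun p => (y p : CantorFun)),
    ⟨hs, fun c => (hx' c).trans (norm_comb_coe X x c).symm,
      fun c => (hg c).trans (norm_comb_coe Y y c).symm⟩, ?_, rfl⟩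
  exact Prod.ext (spanSB_coe X x hx) (spanSB_coe Y y hy)

theorem isAnalytic_isBPSpace (lam ε : ℝ) (hlam : lam ≠ 0) :
    IsAnalytic {p : SB × SB | ∃ F : ℕ → Submodule ℝ p.1.toSubmodule,
      IsFiltration F ∧ IsBPSpace lam ε F p.2.toSubmodule} := by
  convert! isAnalytic_image (measurableSet_codes lam ε) measurable_decode using 1
  ext ⟨X, Y⟩
  constructor
  · rintro ⟨F, hF, h⟩
    obtain ⟨x, hxF, hx⟩ := IsFiltration.exists_generators (X := X.toSubmodule) hF
    obtain ⟨z, hz, hzp, -⟩ := exists_mem_codes_of_isBPSpace hlam hxF hx h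
    exact ⟨z, hz, hzp⟩
  · rintro ⟨z, hz, h⟩
    rw [← h]
    -- The sequence F is read off from the generators in `z.1`; that it is a filtration is deduced
    -- afterwards from the run itself.
    have hBP := isBPSpace_of_mem_codes (X := spanSB z.1) (Y := spanSB z.2.2.2.2.2) hlam
      (fun _ => rfl) (closedSpan_spanSBGen z.1) (closedSpan_spanSBGen z.2.2.2.2.2) hz rfl rfl
    exact ⟨_, isFiltration_of_generators (X := (spanSB z.1).toSubmodule)
      (fun k => hBP.finiteDimensional (X := (spanSB z.1).toSubmodule)
        (Y := (spanSB z.2.2.2.2.2).toSubmodule) k) (fun _ => rfl) (closedSpan_spanSBGen z.1), hBP⟩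

theorem isAnalytic_isBPSpace_selectorSpan (lam ε : ℝ) (hlam : lam ≠ 0) (d : ℕ → SB → CantorFun)
    (hd : ∀ n, Measurable (d n)) (hmem : ∀ n X, d n X ∈ X)
    (hdense : ∀ X : SB, closure (Set.range fun n => d n X) = (X : Set _)) :
    IsAnalytic {p : SB × SB | IsBPSpace lam ε (selectorSpan d p.1) p.2.toSubmodule} := by
  -- The added condition x (l, i) = d_l(X), with i a dummy index, ties the generators to the
  -- selectors. Both sides are Borel in the code, since X is the Borel function `spanSB` of the
  -- generators.
  have hB : MeasurableSet (codes lam ε ∩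
      {z : CodeSpace | ∀ p : ℕ × ℕ, z.1 p = d p.1 (spanSB z.1)}) := by
    refine (measurableSet_codes lam ε).inter ?_
    rw [Set.ofPred_forall]
    refine MeasurableSet.iInter fun p => measurableSet_eq_fun ?_ ?_
    · exact (measurable_pi_apply p).comp measurable_fst
    · exact (hd p.1).comp (measurable_spanSB.comp measurable_fst)
  have hsel : ∀ (X : SB) (x : ℕ × ℕ → X.toSubmodule), (∀ p, (x p : CantorFun) = d p.1 X) →
      ∀ k, selectorSpan d X k = Submodule.span ℝ (x '' {p | p.1 ≤ k}) := by
    intro X x hx k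
    refine congrArg (Submodule.span ℝ) (Set.ext fun v => ?_)
    constructor
    · rintro ⟨i, hi, hv⟩
      exact ⟨(i, 0), hi, Subtype.ext ((hx _).trans hv.symm)⟩
    · rintro ⟨p, hp, rfl⟩
      exact ⟨p.1, hp, hx p⟩
  convert! isAnalytic_image hB measurable_decode using 1
  ext ⟨X, Y⟩
  constructor
  · intro h
    let x : ℕ × ℕ → X.toSubmodule := fun p => ⟨d p.1 X, hmem p.1 X⟩
    have hx : closedSpan x = ⊤ := by
      refine closedSpan_eq_top_of_range (fun p : ℕ × ℕ => d p.1 X) x X.toSubmodule.subtypeₗᵢ ?_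
        fun _ => rfl
      rintro _ ⟨v, rfl⟩
      have hv : (v : CantorFun) ∈ closure (Set.range fun n => d n X) := by
        rw [hdense]
        exact v.2
      refine closure_mono ?_ hv
      rintro _ ⟨n, rfl⟩
      exact Submodule.subset_span ⟨(n, 0), rfl⟩
    obtain ⟨z, hz, hzp, hz1⟩ := exists_mem_codes_of_isBPSpace hlam (hsel X x fun _ => rfl) hx h
    refine ⟨z, ⟨hz, fun p => ?_⟩, hzp⟩
    have : spanSB z.1 = X := congrArg Prod.fst hzp
    rw [this, hz1]
  · rintro ⟨z, ⟨hz, hzd⟩, h⟩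
    rw [← h]
    exact isBPSpace_of_mem_codes (X := spanSB z.1) (Y := spanSB z.2.2.2.2.2) hlam
      (hsel _ (spanSBGen z.1) hzd) (closedSpan_spanSBGen z.1) (closedSpan_spanSBGen z.2.2.2.2.2)
      hz rfl rfl

end BourgainPisier

end

theorem mainTheorem6 (lam η ε : ℝ) (hlam : 1 < lam) (hη : 1 / lam < η) (hη1 : η < 1)
    (hε : 0 < ε) (hε1 : 1 + ε < lam * η) :
    (∀ (X : BourgainPisier.SB) (F : ℕ → Submodule ℝ X.toSubmodule),
      BourgainPisier.IsFiltration F →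
        ∃ Y : BourgainPisier.SB, BourgainPisier.IsBPSpace lam ε F Y.toSubmodule) ∧
    BourgainPisier.IsAnalytic
      {p : BourgainPisier.SB × BourgainPisier.SB |
        ∃ F : ℕ → Submodule ℝ p.1.toSubmodule,
          BourgainPisier.IsFiltration F ∧ BourgainPisier.IsBPSpace lam ε F p.2.toSubmodule} ∧
    (∀ d : ℕ → BourgainPisier.SB → BourgainPisier.CantorFun,
      (∀ n, Measurable (d n)) →
      (∀ n X, d n X ∈ X) →
      (∀ X : BourgainPisier.SB, closure (Set.range fun n => d n X) = (X : Set _)) →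
      BourgainPisier.IsAnalytic
        {p : BourgainPisier.SB × BourgainPisier.SB |
          BourgainPisier.IsBPSpace lam ε
            (BourgainPisier.selectorSpan d p.1) p.2.toSubmodule}) := by
  -- From 1 + ε < λη and η < 1.
  have hle : 1 + ε ≤ lam := hε1.le.trans (mul_le_of_le_one_right (by linarith) hη1.le)
  have hlam0 : lam ≠ 0 := by linarith
  exact ⟨fun X F hF => BourgainPisier.exists_isBPSpace (X := X.toSubmodule) hlam hε hle F hF.finite,
    BourgainPisier.isAnalytic_isBPSpace lam ε hlam0,
    fun d hd hmem hdense =>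
      BourgainPisier.isAnalytic_isBPSpace_selectorSpan lam ε hlam0 d hd hmem hdense⟩
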